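/- All graphs are finite, without loops or multiple edges. A graph is cubic if every vertex has exactly three neighbors. A *3-edge-decomposition* of a graph $H$ is a partition of its edge set into three classes such that no two adjacent edges are in the same class; $ED(H)$ is the set of these. A graph $H$ is *cyclically $4$-edge-connected* if, for any two vertex-disjoint cycles $C_1,C_2$ of $H$ and any set $S$ of at most three edges of $H$, none of them on $C_1$ or $C_2$, the graph $H-S$ contains a path from a vertex of $C_1$ to a vertex of $C_2$. A *snark* is a connected cubic graph of girth at least $5$ that is cyclically $4$-edge-connected and is not edge-3-colorable. For a cubic graph $H$ of girth at least $5$ and an edge $e=(p,q)$ of $H$, let $H_e$ be the cubic graph obtained from $H$ by deleting the vertices $p,q$ (and all edges at them), and then adding two edges: one joining the two neighbors of $p$ other than $q$, and one joining the two neighbors of $q$ other than $p$. Put $\psi(H,e)=\tfrac13\,\mathrm{card}\,ED(H_e)$. **Theorem 5.3.** Let $G'$ be a snark and $E=(U,V)$ an edge of $G'$. Let $T_{-2},T_2$ be the neighbors of $U$ other than $V$, and $W_{-2},W_2$ the neighbors of $V$ other than $U$. Let $G^*$ be a snark disjoint from $G'$, and let $u\ne v$ be nonadjacent vertices of $G^*$.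 Let $u_{-1},u_0,u_1$ be the neighbors of $u$ and $v_{-1},v_0,v_1$ the neighbors of $v$ in $G^*$, each triple in any order (some $u_i$ may equal some $v_j$). Let $G$ be the graph that consists of $G'-\{U,V\}$, $G^*-\{u,v\}$, six new vertices $T_i,W_i$ $(i\in\{-1,0,1\})$, and the fourteen new edges $(T_i,T_{i+1})$ and $(W_i,W_{i+1})$ for $i\in\{-2,-1,0,1\}$, and $(T_i,u_i)$ and $(v_i,W_i)$ for $i\in\{-1,0,1\}$. Then $G$ is a cubic graph of girth at least $5$, and every edge $e$ of $G^*-\{u,v\}$ is an edge of $G$ and satisfies $$\psi(G,e)=2\cdot\psi(G^*,e)\cdot\psi(G',E).$$ -/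

import Mathlib

namespace Snark

/-- Every vertex is 3-valent. -/
def IsCubic {V : Type*} (G : SimpleGraph V) : Prop :=
  ∀ x : V, (G.neighborSet x).ncard = 3

/-- `G` is (at least) cyclically `n`-edge-connected: if fewer than `n` edges are deleted, none of
them on either of two given (vertex-)disjoint cycles, then some path still joins the two cycles.
(For a connected cubic graph of girth at least 5, two disjoint cycles always exist.) -/
def CyclicallyEdgeConnected {V : Type*} (G : SimpleGraph V) (n : ℕ) : Prop :=
  ∀ (a b : V) (C : G.Walk a a) (D : G.Walk b b), C.IsCycle → D.IsCycle →
    C.support.Disjoint D.support →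
    ∀ S : Finset (Sym2 V), (S : Set (Sym2 V)) ⊆ G.edgeSet → S.card < n →
      (∀ e ∈ S, e ∉ C.edges ∧ e ∉ D.edges) →
      ∃ x ∈ C.support, ∃ y ∈ D.support, (G.deleteEdges (S : Set (Sym2 V))).Reachable x y

/-- Snarks: connected cubic graphs of girth at least 5, cyclically 4-edge-connected, and not
edge-3-colorable (a proper edge coloring is a proper vertex coloring of the line graph). -/
structure IsSnark {V : Type*} (G : SimpleGraph V) : Prop where
  connected : G.Connected
  cubic : IsCubic G
  girth : 5 ≤ G.egirth
  cyclically : CyclicallyEdgeConnected G 4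
  uncolorable : ¬ G.lineGraph.Colorable 3

/-- The 3-edge-decompositions of `H`: partitions of the edge set (given as equivalence relations
on it) into three classes such that no two adjacent edges lie in the same class. -/
def edgeDecompositions {V : Type*} (H : SimpleGraph V) : Set (Setoid H.edgeSet) :=
  {r | Nat.card (Quotient r) = 3 ∧ ∀ d e : H.edgeSet, H.lineGraph.Adj d e → ¬ r d e}

/-- The graph `G_e`: delete both ends of the edge `e`, and for each end `z` of `e`, join by a new
edge the two remaining neighbors of `z`. -/
def removeEdge {V : Type*} (G : SimpleGraph V) (e : Sym2 V) : SimpleGraph {x : V // x ∉ e} where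
  Adj x y := x ≠ y ∧ (G.Adj x y ∨ ∃ z ∈ e, G.Adj z x ∧ G.Adj z y)
  symm := ⟨by
    rintro x y ⟨hne, h | ⟨z, hz, hx, hy⟩⟩
    · exact ⟨hne.symm, Or.inl h.symm⟩
    · exact ⟨hne.symm, Or.inr ⟨z, hz, hy, hx⟩⟩⟩
  loopless := ⟨fun _ h => h.1 rfl⟩

/-- The number `ψ(G, e)`: one third of the number of 3-edge-decompositions of `G_e`. The value
is a rational number, so that nothing is rounded. -/
noncomputable def psi {V : Type*} (G : SimpleGraph V) (e : Sym2 V) : ℚ :=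
  ((edgeDecompositions (removeEdge G e)).ncard : ℚ) / 3

/-- The data for superposing `Gs` (the graph `G*`) on the edge `UV` of `G'`. The index `-1, 0, 1`
of a strand is represented by `0, 1, 2 : Fin 3`. As the graphs will be cubic, the
vertices listed as neighbors of a vertex are automatically distinct. -/
structure SuperpositionData {α β : Type*} (G' : SimpleGraph α) (Gs : SimpleGraph β) where
  /-- the ends of the edge of `G'` that is replaced -/
  U : α
  V : α
  adj_UV : G'.Adj U V
  /-- the neighbors `T₋₂, T₂` of `U` other than `V` -/
  Tneg : α
  Tpos : α
  neighbors_U : G'.neighborSet U = {V, Tneg, Tpos}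
  /-- the neighbors `W₋₂, W₂` of `V` other than `U` -/
  Wneg : α
  Wpos : α
  neighbors_V : G'.neighborSet V = {U, Wneg, Wpos}
  /-- the two nonadjacent vertices of `G*` that are split into strands -/
  u : β
  v : β
  u_ne_v : u ≠ v
  not_adj_uv : ¬ Gs.Adj u v
  /-- the three neighbors of `u` -/
  us : Fin 3 → β
  neighbors_u : Gs.neighborSet u = Set.range us
  /-- the three neighbors of `v` -/
  vs : Fin 3 → β
  neighbors_v : Gs.neighborSet v = Set.range vs

namespace SuperpositionData

variable {α β : Type*} {G' : SimpleGraph α} {Gs : SimpleGraph β}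

/-- The vertices of the superposition: those of `G' - {U, V}`, those of `G* - {u, v}`, and six new
vertices `T₋₁, T₀, T₁` and `W₋₁, W₀, W₁`. -/
inductive Vertex (K : SuperpositionData G' Gs)
  | base (x : ({K.U, K.V}ᶜ : Set α)) : Vertex K
  | inner (y : ({K.u, K.v}ᶜ : Set β)) : Vertex K
  | T (i : Fin 3) : Vertex K
  | W (i : Fin 3) : Vertex K

/-- The edges of the superposition, each in one direction at least. -/
def Rel (K : SuperpositionData G' Gs) : K.Vertex → K.Vertex → Prop
  | .base x, .base y => G'.Adj x y
  | .inner x, .inner y => Gs.Adj x y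
  | .T i, .T j => (i : ℕ) + 1 = j
  | .W i, .W j => (i : ℕ) + 1 = j
  | .T i, .base x => (i = 0 ∧ (x : α) = K.Tneg) ∨ (i = 2 ∧ (x : α) = K.Tpos)
  | .W i, .base x => (i = 0 ∧ (x : α) = K.Wneg) ∨ (i = 2 ∧ (x : α) = K.Wpos)
  | .T i, .inner y => (y : β) = K.us i
  | .W i, .inner y => (y : β) = K.vs i
  | _, _ => False

/-- The superposition `G`. -/
def graph (K : SuperpositionData G' Gs) : SimpleGraph K.Vertex :=
  SimpleGraph.fromRel K.Rel

end SuperpositionData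

end Snark

namespace Snark

/-! Edges are colored with the nonzero elements of the Klein four-group, because three distinct ones
sum to zero. Every 3-edge-decomposition comes from six colorings. A coloring of `removeEdge H e` is
the same as a split coloring of `H`: a coloring of `H - e`, proper away from the ends of `e`, in
which the two edges left at each end of `e` have equal colors. Writing `N(H, e)` for the number of
split colorings, `psi H e = N(H, e) / 18` (`psi_eq`), and the claim becomes `9 * N(G, e) = N(G*, e)
* N(G', UV)`.

Two facts about a cubic graph that is not 3-edge-colorable carry the count. Parity
(`IsPartialColoring.isSplitColoring`): summing the colors over all vertices counts every edge twice,
so the color sums at the two ends of the missing edge agree. If this sum were nonzero, it could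
serve as the color of that edge; so it is zero, and splitness is automatic. Equidistribution
(`card_splitColoring_eq`): if moreover the girth is at least 5, a Kempe switch changes the color at
one end of the missing edge and leaves the color at the other end alone, so all nine pairs of colors
at the two ends occur equally often.

A split coloring of the superposition restricts to a partial coloring of `G'` with `UV` missing. By
parity this is split, so both outer edges of a strand have one color `k`. The two edges along the
strand then have the other two colors, and the three edges to `G*` have all three colors, the middle
one being `k`. Contracting the strands to `u` and `v` therefore gives a split coloring of `G*`, and
everything can be reversed (`Distinct.splitColoringEquiv`): the split colorings of the superposition
are the pairs that agree on one color at `U` and one at `V`. By equidistribution in `G'`, each split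
coloring of `G*` fits exactly one ninth of those of `G'`. -/

/-! ### Girth at least 5: no triangles and no quadrilaterals -/

theorem five_le_egirth_iff {V : Type*} {G : SimpleGraph V} :
    5 ≤ G.egirth ↔ (∀ x y z, G.Adj x y → G.Adj y z → ¬ G.Adj z x) ∧
      ∀ x y z w, G.Adj x y → G.Adj y z → G.Adj z w → G.Adj w x → x = z ∨ y = w := by
  rw [SimpleGraph.le_egirth]
  constructor
  · intro h
    refine ⟨fun x y z hxy hyz hzx => ?_, fun x y z w hxy hyz hzw hwx => ?_⟩
    · have := h x (.cons hxy (.cons hyz (.cons hzx .nil))) (by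
        have := hxy.ne; have := hyz.ne; have := hzx.ne
        rw [SimpleGraph.Walk.cons_isCycle_iff]
        constructor <;> simp <;> grind)
      simp at this
      norm_num at this
    · by_contra! hne
      have := h x (.cons hxy (.cons hyz (.cons hzw (.cons hwx .nil)))) (by
        have := hxy.ne; have := hyz.ne; have := hzw.ne; have := hwx.ne
        rw [SimpleGraph.Walk.cons_isCycle_iff]
        constructor <;> simp <;> grind)
      simp at this
      norm_num at this
  · rintro ⟨h3, h4⟩ a w hw
    have hl := hw.three_le_length
    by_contra! hlt
    have hlt' : w.length < 5 := by exact_mod_cast hlt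
    match w, hw, hl, hlt' with
    | .cons h1 (.cons h2 (.cons h3' .nil)), _, _, _ => exact h3 _ _ _ h1 h2 h3'
    | .cons h1 (.cons h2 (.cons h3' (.cons h4' .nil))), hw, _, _ =>
      have := h4 _ _ _ _ h1 h2 h3' h4'
      have := hw.support_nodup
      simp at this
      grind
    | .cons h1 (.cons h2 (.cons h3' (.cons h4' (.cons _ _)))), _, _, hh =>
      simp at hh; omega

/-! ### Decompositions and colorings -/

/-- Six times the number of 3-edge-decompositions is the number of proper edge colorings with a
given set of three colors. -/
theorem card_coloring_eq {V : Type*} [Finite V] {C : Type*} [Finite C] (hC : Nat.card C = 3)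
    {H : SimpleGraph V} {x₀ : V} (hx₀ : (H.neighborSet x₀).ncard = 3) :
    Nat.card (H.lineGraph.Coloring C) = 6 * (edgeDecompositions H).ncard := by
  classical
  -- The three edges at `x₀` already use every color, so the color classes always number exactly
  -- three.
  have hsurj (f : H.lineGraph.Coloring C) : Function.Surjective f := by
    have hinj : Function.Injective
        (fun y : H.neighborSet x₀ => f ⟨s(x₀, y), y.2⟩) := by
      intro y z hyz
      by_contra hne
      refine f.valid (v := ⟨s(x₀, y), y.2⟩) (w := ⟨s(x₀, z), z.2⟩) ?_ hyz
      rw [SimpleGraph.lineGraph_adj_iff_exists]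
      refine ⟨?_, x₀, by simp, by simp⟩
      intro h
      apply hne
      have h' : s(x₀, (y : V)) = s(x₀, (z : V)) := congrArg Subtype.val h
      exact Subtype.ext (Sym2.congr_right.mp h')
    have hb := hinj.bijective_of_nat_card_le (by
      rw [hC]
      exact hx₀.ge)
    intro k
    obtain ⟨y, hy⟩ := hb.2 k
    exact ⟨_, hy⟩
  let F : H.lineGraph.Coloring C → edgeDecompositions H := fun f => ⟨Setoid.ker f, by
    refine ⟨?_, fun d e hde h => f.valid hde h⟩
    rw [Nat.card_congr (Setoid.quotientKerEquivOfSurjective f (hsurj f)), hC]⟩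
  -- The colorings with color classes `r` are the bijections from the three classes to the three
  -- colors: `3! = 6`.
  have hfib (r : edgeDecompositions H) : Nat.card {f // F f = r} = 6 := by
    have hr := r.2.1
    let g : (Quotient r.1 ≃ C) → {f // F f = r} := fun g =>
      ⟨SimpleGraph.Coloring.mk (fun d => g (Quotient.mk r.1 d)) (by
        intro d e hde h
        exact r.2.2 d e hde (Quotient.exact (g.injective h))), by
        ext d e
        simp only [F, Setoid.ker_def]
        change g _ = g _ ↔ _
        rw [g.injective.eq_iff]
        exact Quotient.eq⟩
    have hg : Function.Bijective g := by
      constructor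
      · intro g₁ g₂ h
        ext q
        induction q using Quotient.inductionOn with
        | h d => exact congrArg (fun f => f.1 d) h
      · rintro ⟨f, rfl⟩
        refine ⟨Setoid.quotientKerEquivOfSurjective f (hsurj f), ?_⟩
        ext d
        rfl
    rw [← Nat.card_congr (Equiv.ofBijective g hg)]
    have : Finite (Quotient r.1) := Nat.finite_of_card_ne_zero (by omega)
    have := Fintype.ofFinite (Quotient r.1)
    have := Fintype.ofFinite C
    rw [Nat.card_eq_fintype_card] at hr hC ⊢
    rw [Fintype.card_equiv (Fintype.equivOfCardEq (hr.trans hC.symm)), hr]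
    rfl
  rw [← Nat.card_congr (Equiv.sigmaFiberEquiv F)]
  have : Finite (Setoid H.edgeSet) :=
    Finite.of_injective (fun r => (r : H.edgeSet → H.edgeSet → Prop)) fun r s h =>
      Setoid.ext fun a b => iff_of_eq (congrFun (congrFun h a) b)
  have := Fintype.ofFinite (edgeDecompositions H)
  have hfin (r) : Finite {f // F f = r} := Nat.finite_of_card_ne_zero (by rw [hfib]; norm_num)
  rw [Nat.card_sigma]
  simp only [hfib]
  rw [Finset.sum_const, ← Nat.card_coe_set_eq, Nat.card_eq_fintype_card]
  simp [mul_comm]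


/-! ### Colorings as Klein-valued matrices -/

/-- The Klein four-group. Its nonzero elements serve as the three colors. -/
abbrev Klein := ZMod 2 × ZMod 2

/-- Proper edge colorings with nonzero values in the Klein four-group, written as symmetric
matrices whose zero entries are the nonadjacent pairs. -/
structure IsEdgeColoring {V : Type*} (H : SimpleGraph V) (c : V → V → Klein) : Prop where
  symm : ∀ x y, c x y = c y x
  ne_zero_iff : ∀ x y, c x y ≠ 0 ↔ H.Adj x y
  proper : ∀ x y z, c x y ≠ 0 → c x y = c x z → y = z

theorem card_nonzero_klein : Nat.card {k : Klein // k ≠ 0} = 3 := by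
  rw [Nat.card_eq_fintype_card]
  decide

/-- A proper edge coloring as a proper vertex coloring of the line graph. -/
def IsEdgeColoring.toLineGraph {V : Type*} {H : SimpleGraph V} {c : V → V → Klein}
    (hc : IsEdgeColoring H c) : H.lineGraph.Coloring {k : Klein // k ≠ 0} :=
  SimpleGraph.Coloring.mk
    (fun d => ⟨Sym2.lift ⟨c, hc.symm⟩ d.1, by
      obtain ⟨d, hd⟩ := d
      induction d with
      | h x y => exact (hc.ne_zero_iff x y).2 hd⟩) (by
    rintro ⟨d, hd⟩ ⟨e, he⟩ hde h
    rw [SimpleGraph.lineGraph_adj_iff_exists] at hde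
    obtain ⟨hne, x, hxd, hxe⟩ := hde
    obtain ⟨y, rfl⟩ := Sym2.mem_iff_exists.1 hxd
    obtain ⟨z, rfl⟩ := Sym2.mem_iff_exists.1 hxe
    apply hne
    have h' : c x y = c x z := congrArg Subtype.val h
    rw [Subtype.mk.injEq, hc.proper x y z ((hc.ne_zero_iff x y).2 hd) h'])

theorem IsEdgeColoring.colorable {V : Type*} {H : SimpleGraph V} {c : V → V → Klein}
    (hc : IsEdgeColoring H c) : H.lineGraph.Colorable 3 := by
  have := hc.toLineGraph.colorable
  rwa [← Nat.card_eq_fintype_card, card_nonzero_klein] at this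

theorem card_isEdgeColoring {V : Type*} (H : SimpleGraph V) :
    Nat.card {c // IsEdgeColoring H c} =
      Nat.card (H.lineGraph.Coloring {k : Klein // k ≠ 0}) := by
  classical
  refine Nat.card_congr (Equiv.ofBijective (fun c => c.2.toLineGraph) ⟨?_, ?_⟩)
  · intro c d h
    ext1
    funext x y
    by_cases hxy : H.Adj x y
    · exact congrArg (fun f => (f ⟨s(x, y), hxy⟩).1) h
    · rw [← d.2.ne_zero_iff, not_not] at hxy
      rw [hxy, ← not_not (a := _ = _), ← ne_eq, c.2.ne_zero_iff, ← d.2.ne_zero_iff, not_not, hxy]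
  · intro f
    refine ⟨⟨fun x y => if h : H.Adj x y then (f ⟨s(x, y), h⟩).1 else 0, ?_, ?_, ?_⟩, ?_⟩
    · intro x y
      simp only [H.adj_comm x y]
      split_ifs with h
      · exact congrArg (fun d => (f d).1) (Subtype.ext Sym2.eq_swap)
      · rfl
    · intro x y
      split_ifs with h
      · exact iff_of_true (f _).2 h
      · exact iff_of_false (by simp) h
    · intro x y z
      split_ifs with h h'
      · intro _ heq
        by_contra hne
        refine f.valid (v := ⟨s(x, y), h⟩) (w := ⟨s(x, z), h'⟩) ?_ (Subtype.ext heq)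
        rw [SimpleGraph.lineGraph_adj_iff_exists]
        refine ⟨fun h => hne ?_, x, by simp, by simp⟩
        exact Sym2.congr_right.mp (congrArg Subtype.val h)
      · exact fun h1 h2 => absurd h2 h1
      · exact fun h1 => absurd rfl h1
      · exact fun h1 => absurd rfl h1
    · ext1 ⟨d, hd⟩
      induction d with
      | h x y =>
        apply Subtype.ext
        exact dif_pos hd

/-! ### Split colorings and the graph with an edge removed -/

/-- Matrices that are proper edge colorings of `G`, with the edge `e` deleted, except that nothing
is required at the two ends of `e`. -/
structure IsPartialColoring {V : Type*} (G : SimpleGraph V) (e : Sym2 V) (c : V → V → Klein) :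
    Prop where
  symm : ∀ x y, c x y = c y x
  ne_zero_iff : ∀ x y, c x y ≠ 0 ↔ G.Adj x y ∧ s(x, y) ≠ e
  proper : ∀ x ∉ e, ∀ y z, c x y ≠ 0 → c x y = c x z → y = z

/-- Partial colorings that are constant on the edges other than `e` at either end of `e`. They
correspond to the edge colorings of `removeEdge G e`. -/
structure IsSplitColoring {V : Type*} (G : SimpleGraph V) (e : Sym2 V) (c : V → V → Klein) : Prop
    extends IsPartialColoring G e c where
  ends : ∀ x ∈ e, ∀ y z, c x y ≠ 0 → c x z ≠ 0 → c x y = c x z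


theorem IsCubic.exists_neighbors {V : Type*} {G : SimpleGraph V} (hG : IsCubic G) {p q : V}
    (hpq : G.Adj p q) :
    ∃ a b, a ≠ q ∧ b ≠ q ∧ a ≠ b ∧ ∀ y, G.Adj p y ↔ y = q ∨ y = a ∨ y = b := by
  obtain ⟨x, y, z, hxy, hxz, hyz, h⟩ := Set.ncard_eq_three.1 (hG p)
  have h' (w) : G.Adj p w ↔ w = x ∨ w = y ∨ w = z := by
    rw [← SimpleGraph.mem_neighborSet, h]; simp
  rcases (h' q).1 hpq with rfl | rfl | rfl
  · exact ⟨y, z, by grind⟩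
  · exact ⟨x, z, by grind⟩
  · exact ⟨x, y, by grind⟩

theorem mem_of_mk_eq {V : Type*} {x y p q : V} (h : s(x, y) = s(p, q)) : y ∈ s(p, q) :=
  h ▸ Sym2.mem_mk_right x y

theorem removeEdge_adj {V : Type*} {G : SimpleGraph V} {p q : V} (x y : {x // x ∉ s(p, q)}) :
    (removeEdge G s(p, q)).Adj x y ↔
      x.1 ≠ y ∧ (G.Adj x y ∨ (G.Adj p x ∧ G.Adj p y) ∨ (G.Adj q x ∧ G.Adj q y)) := by
  simp [removeEdge, Subtype.ext_iff]

theorem IsCubic.exists_removeEdge_adj {V : Type*} {G : SimpleGraph V} (hG : IsCubic G)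
    {p q z x : V} (hz : z ∈ s(p, q)) (hx : x ∉ s(p, q)) (hzx : G.Adj z x) :
    ∃ y : {x // x ∉ s(p, q)}, y.1 ≠ x ∧ G.Adj z y ∧ (removeEdge G s(p, q)).Adj ⟨x, hx⟩ y := by
  obtain ⟨y, hyx, hzy, hy⟩ : ∃ y, y ≠ x ∧ G.Adj z y ∧ y ∉ s(p, q) := by
    obtain ⟨a, b, h1, h2, hab, hN⟩ := hG.exists_neighbors hzx
    have ha := (hN a).2 (by simp)
    have hb := (hN b).2 (by simp)
    have := ha.ne
    have := hb.ne
    simp only [Sym2.mem_iff] at hz hx ⊢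
    by_cases h7 : a = p ∨ a = q
    · exact ⟨b, h2, hb, by grind⟩
    · exact ⟨a, h1, ha, h7⟩
  refine ⟨⟨y, hy⟩, hyx, hzy, ?_⟩
  rw [removeEdge_adj]
  refine ⟨hyx.symm, Or.inr ?_⟩
  rcases Sym2.mem_iff.1 hz with rfl | rfl
  · exact Or.inl ⟨hzx, hzy⟩
  · exact Or.inr ⟨hzx, hzy⟩

open Classical in
/-- The edge coloring of `removeEdge G s(p, q)` that corresponds to a split coloring. -/
noncomputable def mergeEnds {V : Type*} (G : SimpleGraph V) (p q : V) (d : V → V → Klein)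
    (x y : {x // x ∉ s(p, q)}) : Klein :=
  if x.1 ≠ y ∧ G.Adj p x ∧ G.Adj p y then d p x
  else if x.1 ≠ y ∧ G.Adj q x ∧ G.Adj q y then d q x
  else d x y

open Classical in
/-- The color that a coloring of `removeEdge G s(p, q)` gives to the edge that replaces `z`. -/
noncomputable def endColor {V : Type*} (G : SimpleGraph V) (p q : V)
    (c : {x // x ∉ s(p, q)} → {x // x ∉ s(p, q)} → Klein) (z : V) : Klein :=
  if h : ∃ x y : {x // x ∉ s(p, q)}, x ≠ y ∧ G.Adj z x ∧ G.Adj z y then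
    c h.choose h.choose_spec.choose else 0

open Classical in
/-- The split coloring that corresponds to an edge coloring of `removeEdge G s(p, q)`. -/
noncomputable def splitEnds {V : Type*} (G : SimpleGraph V) (p q : V)
    (c : {x // x ∉ s(p, q)} → {x // x ∉ s(p, q)} → Klein) (x y : V) : Klein :=
  if ¬ G.Adj x y then 0
  else if hx : x ∈ s(p, q) then if y ∈ s(p, q) then 0 else endColor G p q c x
  else if hy : y ∈ s(p, q) then endColor G p q c y
  else c ⟨x, hx⟩ ⟨y, hy⟩

/-- An end of the removed edge has only two neighbors off that edge, so the chosen pair is unique up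
to order, and the symmetry of `c` makes the order irrelevant. -/
theorem endColor_eq {V : Type*} {G : SimpleGraph V} (hG : IsCubic G) {p q : V} (hpq : G.Adj p q)
    {c : {x // x ∉ s(p, q)} → {x // x ∉ s(p, q)} → Klein}
    (hc : ∀ x y, c x y = c y x) {z : V} (hz : z ∈ s(p, q)) {x y : {x // x ∉ s(p, q)}}
    (hne : x ≠ y) (hx : G.Adj z x) (hy : G.Adj z y) : endColor G p q c z = c x y := by
  have h : ∃ x y : {x // x ∉ s(p, q)}, x ≠ y ∧ G.Adj z x ∧ G.Adj z y := ⟨x, y, hne, hx, hy⟩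
  rw [endColor, dif_pos h]
  have h1 := h.choose_spec.choose_spec
  set x' := h.choose
  set y' := h.choose_spec.choose
  obtain ⟨w, hw, hzw⟩ : ∃ w ∈ s(p, q), G.Adj z w := by
    rcases Sym2.mem_iff.1 hz with rfl | rfl
    · exact ⟨q, by simp, hpq⟩
    · exact ⟨p, by simp, hpq.symm⟩
  obtain ⟨a, b, -, -, hab, hN⟩ := hG.exists_neighbors hzw
  have hne' : ∀ x : {x // x ∉ s(p, q)}, x.1 ≠ w := fun x h => x.2 (h ▸ hw)
  have key : ∀ x : {x // x ∉ s(p, q)}, G.Adj z x → x.1 = a ∨ x.1 = b := fun x hx =>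
    ((hN x).1 hx).resolve_left (hne' x)
  have h2 := key _ hx
  have h3 := key _ hy
  have h4 := key _ h1.2.1
  have h5 := key _ h1.2.2
  have h6 := h1.1
  have : (x' = x ∧ y' = y) ∨ (x' = y ∧ y' = x) := by
    simp only [Subtype.ext_iff, ne_eq] at *
    grind
  rcases this with ⟨e1, e2⟩ | ⟨e1, e2⟩
  · change c x' y' = _
    rw [e1, e2]
  · change c x' y' = _
    rw [e1, e2, hc]

/-- Each new edge inherits the common color of the two edges it replaces. Without triangles, a new
edge never duplicates an old edge or the other new edge, so the colors around a surviving vertex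
stay the same. -/
theorem IsSplitColoring.mergeEnds {V : Type*} {G : SimpleGraph V} (hG : IsCubic G)
    (hg : 5 ≤ G.egirth) {p q : V} (hpq : G.Adj p q) {d : V → V → Klein}
    (hd : IsSplitColoring G s(p, q) d) :
    IsEdgeColoring (removeEdge G s(p, q)) (mergeEnds G p q d) := by
  obtain ⟨h3, h4⟩ := five_le_egirth_iff.1 hg
  have hs := hd.symm
  have hn := hd.ne_zero_iff
  have hp := hd.proper
  have he := hd.ends
  have hadj := G.adj_comm
  have hpN (x : {x // x ∉ s(p, q)}) (h : G.Adj p x) : d p x ≠ 0 := by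
    rw [hn]; refine ⟨h, fun h' => x.2 (mem_of_mk_eq h')⟩
  have hqN (x : {x // x ∉ s(p, q)}) (h : G.Adj q x) : d q x ≠ 0 := by
    rw [hn]; refine ⟨h, fun h' => x.2 (mem_of_mk_eq h')⟩
  have hpq' (x : {x // x ∉ s(p, q)}) : G.Adj p x → ¬ G.Adj q x := fun h h' =>
    h3 p q x hpq h' h.symm
  refine ⟨fun x y => ?_, fun x y => ?_, fun x y z => ?_⟩
  · unfold Snark.mergeEnds
    have h1 := fun h h' => he p (by simp) x y (hpN x h) (hpN y h')
    have h2 := fun h h' => he q (by simp) x y (hqN x h) (hqN y h')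
    have := hs x y
    grind
  · rw [removeEdge_adj]
    unfold Snark.mergeEnds
    have h1 := hpN x
    have h2 := hqN x
    have h5 := hn x y
    have h6 : s(x.1, y.1) ≠ s(p, q) := fun h => x.2 (mem_of_mk_eq (Sym2.eq_swap.trans h))
    have h7 : G.Adj x y → x.1 ≠ y := fun h => h.ne
    grind
  · have hxx := hp x x.2
    have hxp : d x p = d p x := hs _ _
    have hxq : d x q = d q x := hs _ _
    have hxp' := hp x x.2 p
    have hxq' := hp x x.2 q
    have hxy' := hp x x.2 y
    have t1 : ∀ w : {x // x ∉ s(p, q)}, G.Adj p x → G.Adj p w → d x w = 0 := fun w h h' => by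
      by_contra h0
      exact h3 _ _ _ h ((hn _ _).1 h0).1 h'.symm
    have t2 : ∀ w : {x // x ∉ s(p, q)}, G.Adj q x → G.Adj q w → d x w = 0 := fun w h h' => by
      by_contra h0
      exact h3 _ _ _ h ((hn _ _).1 h0).1 h'.symm
    have h1 := hpN x
    have h2 := hqN x
    have h12 := hpq' x
    have nyp : y.1 ≠ p ∧ y.1 ≠ q := by have := y.2; simpa using this
    have nzp : z.1 ≠ p ∧ z.1 ≠ q := by have := z.2; simpa using this
    -- Apart from the other end of the removed edge, `r` has only two neighbors, so `x` determines
    -- its partner.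
    have huniq (r : V) (hr : r ∈ s(p, q)) (hx : G.Adj r x) (hy : G.Adj r y) (hz : G.Adj r z)
        (hxy : x.1 ≠ y) (hxz : x.1 ≠ z) : y = z := by
      obtain ⟨w, hw, hzw⟩ : ∃ w ∈ s(p, q), G.Adj r w := by
        rcases Sym2.mem_iff.1 hr with rfl | rfl
        · exact ⟨q, by simp, hpq⟩
        · exact ⟨p, by simp, hpq.symm⟩
      obtain ⟨a, b, -, -, hab, hN⟩ := hG.exists_neighbors hzw
      have hne' : ∀ x : {x // x ∉ s(p, q)}, x.1 ≠ w := fun x h => x.2 (h ▸ hw)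
      have := hne' x
      have := hne' y
      have := hne' z
      rw [hN] at hx hy hz
      ext
      grind
    have hu1 := huniq p (by simp)
    have hu2 := huniq q (by simp)
    rw [Subtype.ext_iff] at *
    unfold Snark.mergeEnds
    grind

theorem IsEdgeColoring.splitEnds {V : Type*} {G : SimpleGraph V} (hG : IsCubic G)
    (hg : 5 ≤ G.egirth) {p q : V} (hpq : G.Adj p q)
    {c : {x // x ∉ s(p, q)} → {x // x ∉ s(p, q)} → Klein}
    (hc : IsEdgeColoring (removeEdge G s(p, q)) c) :
    IsSplitColoring G s(p, q) (splitEnds G p q c) := by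
  obtain ⟨h3, h4⟩ := five_le_egirth_iff.1 hg
  have hadj := G.adj_comm
  have other (z x : V) (hz : z ∈ s(p, q)) (hx : x ∉ s(p, q)) (hzx : G.Adj z x) :
      ∃ y : {x // x ∉ s(p, q)}, y.1 ≠ x ∧ G.Adj z y ∧
        (removeEdge G s(p, q)).Adj ⟨x, hx⟩ y ∧ endColor G p q c z = c ⟨x, hx⟩ y := by
    obtain ⟨y, hyx, hzy, hadj⟩ := hG.exists_removeEdge_adj hz hx hzx
    exact ⟨y, hyx, hzy, hadj, endColor_eq hG hpq hc.symm hz (Subtype.ext_iff.not.2 hyx.symm) hzx hzy⟩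
  have memz (z x : V) (hz : z ∈ s(p, q)) (hx : x ∈ s(p, q)) (h : G.Adj z x) : s(z, x) = s(p, q) := by
    have := h.ne
    simp only [Sym2.mem_iff, Sym2.eq_iff] at *
    grind
  -- the colors around a vertex that survives
  have row (x y : V) (hx : x ∉ s(p, q)) (h : G.Adj x y) :
      ∃ w, (removeEdge G s(p, q)).Adj ⟨x, hx⟩ w ∧ Snark.splitEnds G p q c x y = c ⟨x, hx⟩ w ∧
        ((y ∉ s(p, q) ∧ w.1 = y) ∨ (y ∈ s(p, q) ∧ G.Adj y w ∧ w.1 ≠ x)) := by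
    by_cases hy : y ∈ s(p, q)
    · obtain ⟨w, h1, h2, h5, h6⟩ := other y x hy hx h.symm
      refine ⟨w, h5, ?_, Or.inr ⟨hy, h2, h1⟩⟩
      simp only [Snark.splitEnds, h, hx, hy, not_true_eq_false, if_false, dif_pos, dif_neg,
        not_false_eq_true, h6]
    · refine ⟨⟨y, hy⟩, ?_, ?_, Or.inl ⟨hy, rfl⟩⟩
      · rw [removeEdge_adj]
        exact ⟨h.ne, Or.inl h⟩
      · simp only [Snark.splitEnds, h, hx, hy, not_true_eq_false, if_false, dif_neg,
          not_false_eq_true]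
  have hsymm (x y) : Snark.splitEnds G p q c x y = Snark.splitEnds G p q c y x := by
    unfold Snark.splitEnds
    rw [G.adj_comm x y]
    split_ifs <;> first | rfl | exact hc.symm _ _
  have hzero (x y) (h : ¬ G.Adj x y) : Snark.splitEnds G p q c x y = 0 := by
    simp only [Snark.splitEnds, h, not_false_eq_true, if_true]
  have hzero' (x y) (hx : x ∈ s(p, q)) (hy : y ∈ s(p, q)) : Snark.splitEnds G p q c x y = 0 := by
    simp only [Snark.splitEnds, hx, hy, if_true, dif_pos, ite_self]
  have hnz (x y) (hx : x ∉ s(p, q)) (h : G.Adj x y) : Snark.splitEnds G p q c x y ≠ 0 := by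
    obtain ⟨w, h1, h2, -⟩ := row x y hx h
    rw [h2]
    exact (hc.ne_zero_iff _ _).2 h1
  refine ⟨⟨hsymm, fun x y => ?_, fun x hx y z hy hyz => ?_⟩, fun x hx y z hy hz => ?_⟩
  · constructor
    · intro h
      refine ⟨by_contra fun h' => h (hzero _ _ h'), fun h' => h (hzero' _ _ ?_ ?_)⟩
      · rw [← h']; simp
      · rw [← h']; simp
    · rintro ⟨h, hne⟩
      by_cases hx : x ∈ s(p, q)
      · by_cases hy : y ∈ s(p, q)
        · exact absurd (memz _ _ hx hy h) hne
        · rw [hsymm]; exact hnz _ _ hy h.symm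
      · exact hnz _ _ hx h
  · have ay : G.Adj x y := by_contra fun h' => hy (hzero _ _ h')
    have az : G.Adj x z := by_contra fun h' => hy (hyz.trans (hzero _ _ h'))
    obtain ⟨w, h1, h2, h5⟩ := row x y hx ay
    obtain ⟨w', h1', h2', h5'⟩ := row x z hx az
    have hw := hc.proper _ _ _ ((hc.ne_zero_iff _ _).2 h1) (h2.symm.trans (hyz.trans h2'))
    subst hw
    -- Suppose the edges to `y` and `z` become the same edge of the new graph. If just one of `y`,
    -- `z` is an end of the removed edge, there is a triangle; if both are, `x`, `y`, `w`, `z` is a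
    -- closed 4-walk with `w ≠ x`, so `y = z`.
    rcases h5 with ⟨h6, h7⟩ | ⟨h6, h7, h8⟩ <;> rcases h5' with ⟨h6', h7'⟩ | ⟨h6', h7', h8'⟩
    · rw [← h7, ← h7']
    · exact (h3 _ _ _ ay (h7 ▸ h7'.symm) az.symm).elim
    · exact (h3 _ _ _ az (h7' ▸ h7.symm) ay.symm).elim
    · exact (h4 _ _ _ _ ay h7 h7'.symm az.symm).resolve_left h8.symm
  · have hy' : y ∉ s(p, q) := fun h => hy (hzero' _ _ hx h)
    have hz' : z ∉ s(p, q) := fun h => hz (hzero' _ _ hx h)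
    have ay : G.Adj x y := by_contra fun h' => hy (hzero _ _ h')
    have az : G.Adj x z := by_contra fun h' => hz (hzero _ _ h')
    simp only [Snark.splitEnds, ay, az, hx, hy', hz', dif_pos, if_false, not_true_eq_false]

/-- `mergeEnds` and `splitEnds` are mutually inverse. -/
theorem card_isSplitColoring {V : Type*} {G : SimpleGraph V} (hG : IsCubic G)
    (hg : 5 ≤ G.egirth) {p q : V} (hpq : G.Adj p q) :
    Nat.card {d // IsSplitColoring G s(p, q) d} =
      Nat.card {c // IsEdgeColoring (removeEdge G s(p, q)) c} := by
  obtain ⟨h3, h4⟩ := five_le_egirth_iff.1 hg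
  have hadj := G.adj_comm
  have hpq' (x : V) : G.Adj p x → ¬ G.Adj q x := fun h h' => h3 p q x hpq h' h.symm
  have hsplit {c : {x // x ∉ s(p, q)} → {x // x ∉ s(p, q)} → Klein} {x y : V}
      (hx : x ∉ s(p, q)) (hy : y ∉ s(p, q)) (h : G.Adj x y) :
      splitEnds G p q c x y = c ⟨x, hx⟩ ⟨y, hy⟩ := by
    simp only [splitEnds, h, hx, hy, not_true_eq_false, if_false, dif_neg, not_false_eq_true]
  have hsplit' {c : {x // x ∉ s(p, q)} → {x // x ∉ s(p, q)} → Klein} {z x y : V}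
      (hc : ∀ x y, c x y = c y x) (hz : z ∈ s(p, q)) (hx : x ∉ s(p, q)) (hy : y ∉ s(p, q))
      (hne : x ≠ y) (h : G.Adj z x) (h' : G.Adj z y) :
      splitEnds G p q c z x = c ⟨x, hx⟩ ⟨y, hy⟩ := by
    simp only [splitEnds, h, hz, hx, not_true_eq_false, if_false, dif_pos]
    exact endColor_eq hG hpq hc hz (Subtype.ext_iff.not.2 hne) h h'
  have hmerge {d : V → V → Klein} {z : V} {x y : {x // x ∉ s(p, q)}} (hz : z ∈ s(p, q))
      (hne : x.1 ≠ y) (h : G.Adj z x) (h' : G.Adj z y) : mergeEnds G p q d x y = d z x := by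
    have := hpq' x
    unfold mergeEnds
    rcases Sym2.mem_iff.1 hz with rfl | rfl <;> grind
  have hmerge' {d : V → V → Klein} {x y : {x // x ∉ s(p, q)}} (h : G.Adj x y) :
      mergeEnds G p q d x y = d x y := by
    have h1 := h3 x y p h
    have h2 := h3 x y q h
    unfold mergeEnds
    grind
  refine Nat.card_congr ⟨fun d => ⟨_, d.2.mergeEnds hG hg hpq⟩,
    fun c => ⟨_, c.2.splitEnds hG hg hpq⟩, ?_, ?_⟩
  · rintro ⟨d, hd⟩
    have hm := hd.mergeEnds hG hg hpq
    have hd' := hm.splitEnds hG hg hpq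
    have key (z x : V) (hz : z ∈ s(p, q)) (hx : x ∉ s(p, q)) (h : G.Adj z x) :
        splitEnds G p q (mergeEnds G p q d) z x = d z x := by
      obtain ⟨y, hyx, hzy, -⟩ := hG.exists_removeEdge_adj hz hx h
      rw [hsplit' hm.symm hz hx y.2 hyx.symm h hzy, hmerge hz hyx.symm h hzy]
    ext1
    funext x y
    change splitEnds G p q (mergeEnds G p q d) x y = d x y
    by_cases h : G.Adj x y ∧ s(x, y) ≠ s(p, q)
    · by_cases hx : x ∈ s(p, q)
      · by_cases hy : y ∈ s(p, q)
        · have := h.1.ne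
          have := h.2
          simp only [Sym2.mem_iff, ne_eq, Sym2.eq_iff] at *
          grind
        · exact key _ _ hx hy h.1
      · by_cases hy : y ∈ s(p, q)
        · rw [hd'.symm, hd.symm]
          exact key _ _ hy hx h.1.symm
        · rw [hsplit hx hy h.1, hmerge' h.1]
    · have h1 := (hd.ne_zero_iff x y).not.2 h
      have h2 := (hd'.ne_zero_iff x y).not.2 h
      rw [not_not.1 h1, not_not.1 h2]
  · rintro ⟨c, hc⟩
    have hd := hc.splitEnds hG hg hpq
    have hm := hd.mergeEnds hG hg hpq
    ext1
    funext x y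
    change mergeEnds G p q (splitEnds G p q c) x y = c x y
    by_cases h : (removeEdge G s(p, q)).Adj x y
    · rw [removeEdge_adj] at h
      obtain ⟨hne, h | ⟨h, h'⟩ | ⟨h, h'⟩⟩ := h
      · rw [hmerge' h, hsplit x.2 y.2 h]
      · rw [hmerge (Sym2.mem_mk_left p q) hne h h',
          hsplit' hc.symm (Sym2.mem_mk_left p q) x.2 y.2 hne h h']
      · rw [hmerge (Sym2.mem_mk_right p q) hne h h',
          hsplit' hc.symm (Sym2.mem_mk_right p q) x.2 y.2 hne h h']
    · have h1 := (hc.ne_zero_iff x y).not.2 h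
      have h2 := (hm.ne_zero_iff x y).not.2 h
      rw [not_not.1 h1, not_not.1 h2]


/-- The number `psi G e` in terms of split colorings of `G`. -/
theorem psi_eq {V : Type*} [Finite V] {G : SimpleGraph V} (hG : IsCubic G)
    (hg : 5 ≤ G.egirth) {p q : V} (hpq : G.Adj p q) :
    psi G s(p, q) = (Nat.card {d // IsSplitColoring G s(p, q) d} : ℚ) / 18 := by
  obtain ⟨h3, h4⟩ := five_le_egirth_iff.1 hg
  have hadj := G.adj_comm
  obtain ⟨a, b, haq, hbq, hab, hN⟩ := hG.exists_neighbors hpq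
  have hpa : G.Adj p a := (hN a).2 (by simp)
  have hpb : G.Adj p b := (hN b).2 (by simp)
  obtain ⟨s, t, hsp, htp, hst, hN'⟩ := hG.exists_neighbors hpa.symm
  have has : G.Adj a s := (hN' s).2 (by simp)
  have hat : G.Adj a t := (hN' t).2 (by simp)
  have ha : a ∉ s(p, q) := by simp [haq, hpa.ne']
  -- Some vertex of degree three is needed to see all three colors. At `a`, the new edge to `b`
  -- replaces the edge to `p`; the absence of triangles keeps `b` apart from `s` and `t`.
  have hdeg : ((removeEdge G s(p, q)).neighborSet ⟨a, ha⟩).ncard = 3 := by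
    rw [← Set.ncard_image_of_injective _ Subtype.val_injective]
    have : Subtype.val '' (removeEdge G s(p, q)).neighborSet ⟨a, ha⟩ = {b, s, t} := by
      ext y
      have := h3 _ _ _ hpq.symm hpa
      have := h3 _ _ _ hpa has
      have := h3 _ _ _ hpa hat
      have := hpb.ne
      have := hN y
      have := hN' y
      have := h3 q p a
      have := G.irrefl (v := a)
      simp only [Set.mem_image, SimpleGraph.mem_neighborSet, removeEdge_adj, Subtype.exists,
        exists_and_right, exists_eq_right, Sym2.mem_iff, Set.mem_insert_iff,
        Set.mem_singleton_iff]
      grind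
    rw [this, Set.ncard_eq_three]
    exact ⟨b, s, t, by grind, by grind, hst, rfl⟩
  have key := card_coloring_eq card_nonzero_klein hdeg
  rw [← card_isEdgeColoring, ← card_isSplitColoring hG hg hpq] at key
  rw [psi, key]
  push_cast
  ring


/-! ### The parity lemma -/

theorem klein_add_self (k : Klein) : k + k = 0 := by
  revert k; decide

/-- The reason for coloring with the Klein group: properness at a cubic vertex yields a linear
equation. -/
theorem klein_sum_eq_zero : ∀ k l m : Klein, k ≠ 0 → l ≠ 0 → m ≠ 0 → k ≠ l → k ≠ m → l ≠ m →
    k + l + m = 0 := by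
  decide

/-- Here `k` and `l` are the colors at one end of the missing edge: either they agree, or `s` is the
third color and is free for that edge. -/
theorem klein_sum_facts (k l s : Klein) (hk : k ≠ 0) (hl : l ≠ 0) (hs : s = k + l) :
    k ≠ s ∧ l ≠ s ∧ (k = l ↔ s = 0) := by
  subst hs
  refine ⟨by simpa using hl, by simpa using hk, ?_⟩
  rw [← sub_eq_zero]
  have : k - l = k + l := by
    revert k l; decide
  rw [this]

theorem IsPartialColoring.apply_self {V : Type*} {G : SimpleGraph V} {e : Sym2 V}
    {c : V → V → Klein} (hc : IsPartialColoring G e c) (x : V) : c x x = 0 := by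
  by_contra h
  exact G.irrefl ((hc.ne_zero_iff x x).1 h).1

theorem IsPartialColoring.sum_row {V : Type*} [Fintype V] {G : SimpleGraph V} (hG : IsCubic G)
    {e : Sym2 V} {c : V → V → Klein} (hc : IsPartialColoring G e c) {x : V} (hx : x ∉ e) :
    ∑ y, c x y = 0 := by
  classical
  obtain ⟨a, b, d, hab, had, hbd, h⟩ := Set.ncard_eq_three.1 (hG x)
  have h' (w) : G.Adj x w ↔ w = a ∨ w = b ∨ w = d := by
    rw [← SimpleGraph.mem_neighborSet, h]; simp
  have hn (w) : c x w ≠ 0 ↔ G.Adj x w := by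
    rw [hc.ne_zero_iff]
    exact and_iff_left fun hw => hx (hw ▸ Sym2.mem_mk_left x w)
  have hs : ∑ y, c x y = ∑ y ∈ {a, b, d}, c x y := by
    symm
    apply Finset.sum_subset (Finset.subset_univ _)
    intro w _ hw
    by_contra h0
    have h0 := (h' w).1 ((hn w).1 h0)
    exact hw (by simpa using h0)
  have ha := (hn a).2 ((h' a).2 (by simp))
  have hb := (hn b).2 ((h' b).2 (by simp))
  have hd := (hn d).2 ((h' d).2 (by simp))
  rw [hs, Finset.sum_insert (by simp [hab, had]), Finset.sum_pair hbd, ← add_assoc]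
  exact klein_sum_eq_zero _ _ _ ha hb hd (fun h => hab (hc.proper x hx _ _ ha h))
    (fun h => had (hc.proper x hx _ _ ha h)) (fun h => hbd (hc.proper x hx _ _ hb h))

/-- The sum of all entries vanishes, since each edge is counted twice; all rows other than those of
`p` and `q` vanish too. -/
theorem IsPartialColoring.sum_ends {V : Type*} [Fintype V] {G : SimpleGraph V} (hG : IsCubic G)
    {p q : V} (hpq : p ≠ q) {c : V → V → Klein} (hc : IsPartialColoring G s(p, q) c) :
    ∑ y, c p y = ∑ y, c q y := by
  classical
  have h0 : ∑ x, ∑ y, c x y = 0 := by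
    rw [← Finset.sum_product']
    -- Transposed entries cancel in pairs; the fixed points lie on the diagonal, where the entries
    -- are zero.
    refine Finset.sum_involution (fun z _ => z.swap) ?_ ?_ ?_ ?_
    · rintro ⟨x, y⟩ -
      rw [Prod.swap, hc.symm y x, klein_add_self]
    · rintro ⟨x, y⟩ - h heq
      have hyx : y = x := congrArg Prod.fst heq
      exact h (hyx ▸ hc.apply_self _)
    · simp
    · simp
  have h1 : ∑ x, ∑ y, c x y = ∑ x ∈ {p, q}, ∑ y, c x y := by
    symm
    apply Finset.sum_subset (Finset.subset_univ _)
    intro x _ hx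
    exact hc.sum_row hG (by simpa using hx)
  rw [h1, Finset.sum_pair hpq] at h0
  rw [← sub_eq_zero, ← h0, sub_eq_add_neg]
  congr 1
  rw [neg_eq_iff_add_eq_zero, klein_add_self]

theorem IsPartialColoring.row_end {V : Type*} [Fintype V] {G : SimpleGraph V}
    {p q : V} {c : V → V → Klein} (hc : IsPartialColoring G s(p, q) c) {a b : V}
    (hab : a ≠ b) (hN : ∀ y, G.Adj p y ↔ y = q ∨ y = a ∨ y = b) :
    ∑ y, c p y = c p a + c p b := by
  classical
  rw [← Finset.sum_pair hab]
  symm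
  apply Finset.sum_subset (Finset.subset_univ _)
  intro w _ hw
  by_contra h0
  have h0 := (hc.ne_zero_iff p w).1 h0
  rw [hN] at h0
  grind

theorem IsPartialColoring.end_ne_zero {V : Type*} {G : SimpleGraph V}
    {p q : V} {c : V → V → Klein} (hc : IsPartialColoring G s(p, q) c) {a : V}
    (haq : a ≠ q) (h : G.Adj p a) : c p a ≠ 0 :=
  (hc.ne_zero_iff _ _).2 ⟨h, fun h => haq (Sym2.congr_right.1 h)⟩

theorem IsPartialColoring.end_ne_zero' {V : Type*} {G : SimpleGraph V}
    {p q : V} {c : V → V → Klein} (hc : IsPartialColoring G s(p, q) c) {a : V}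
    (hap : a ≠ p) (h : G.Adj q a) : c q a ≠ 0 :=
  IsPartialColoring.end_ne_zero (by rwa [Sym2.eq_swap]) hap h

/-- In a graph that is not edge-3-colorable, every partial coloring is a split coloring: this is
the parity lemma. -/
theorem IsPartialColoring.isSplitColoring {V : Type*} [Finite V] {G : SimpleGraph V}
    (hG : IsCubic G) (hcol : ¬ G.lineGraph.Colorable 3) {p q : V} (hpq : G.Adj p q)
    {c : V → V → Klein} (hc : IsPartialColoring G s(p, q) c) : IsSplitColoring G s(p, q) c := by
  classical
  have := Fintype.ofFinite V
  refine ⟨hc, ?_⟩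
  have hc' : IsPartialColoring G s(q, p) c := by rwa [Sym2.eq_swap]
  obtain ⟨a, b, haq, hbq, hab, hN⟩ := hG.exists_neighbors hpq
  obtain ⟨a', b', haq', hbq', hab', hN'⟩ := hG.exists_neighbors hpq.symm
  have hsum := hc.sum_ends hG hpq.ne
  have hrow := hc.row_end hab hN
  have hrow' := hc'.row_end hab' hN'
  have ha := hc.end_ne_zero haq ((hN a).2 (by simp))
  have hb := hc.end_ne_zero hbq ((hN b).2 (by simp))
  have ha' := hc'.end_ne_zero haq' ((hN' a').2 (by simp))
  have hb' := hc'.end_ne_zero hbq' ((hN' b').2 (by simp))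
  set s := ∑ y, c p y with hs
  obtain ⟨h1, h2, h3⟩ := klein_sum_facts _ _ _ ha hb hrow
  obtain ⟨h1', h2', h3'⟩ := klein_sum_facts _ _ _ ha' hb' (hsum.trans hrow')
  by_cases h0 : s = 0
  · have hz : c p q = 0 := by
      by_contra h; exact ((hc.ne_zero_iff _ _).1 h).2 rfl
    have hz' : c q p = 0 := by rw [hc.symm, hz]
    intro x hx y z hy hz
    have hay := ((hc.ne_zero_iff _ _).1 hy).1
    have haz := ((hc.ne_zero_iff _ _).1 hz).1
    rcases Sym2.mem_iff.1 hx with rfl | rfl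
    · rw [hN] at hay haz
      grind
    · rw [hN'] at hay haz
      grind
  -- Giving `pq` the nonzero sum `s` would extend `c` to a proper 3-edge-coloring of `G`.
  · refine (hcol (IsEdgeColoring.colorable
      (c := fun x y => if s(x, y) = s(p, q) then s else c x y) ⟨?_, ?_, ?_⟩)).elim
    · intro x y
      simp only [Sym2.eq_swap (a := x), hc.symm x]
    · intro x y
      have := hc.ne_zero_iff x y
      have h : s(x, y) = s(p, q) → G.Adj x y := fun h => by
        rw [← SimpleGraph.mem_edgeSet, h]; exact hpq
      split_ifs <;> grind
    · intro x y z
      by_cases hx : x ∈ s(p, q)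
      · have hy := hc.ne_zero_iff x y
        have hz := hc.ne_zero_iff x z
        have := hpq.ne
        simp only [Sym2.eq_iff]
        rcases Sym2.mem_iff.1 hx with rfl | rfl
        · rw [hN] at hy hz
          grind
        · rw [hN'] at hy hz
          grind
      · have hne : ∀ y, s(x, y) ≠ s(p, q) := fun y h => hx (h ▸ Sym2.mem_mk_left x y)
        simp only [hne, if_false]
        exact hc.proper x hx y z

/-! ### Kempe chains and equidistribution -/

/-- A connected component of a graph with maximum degree two has at most two ends. -/
theorem not_three_ends {V : Type*} [Finite V] {P : SimpleGraph V}
    (h2 : ∀ x, (P.neighborSet x).ncard ≤ 2) {x y z : V} (hxy : P.Reachable x y)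
    (hxz : P.Reachable x z) (hne : x ≠ y) (hne' : x ≠ z) (hne'' : y ≠ z)
    (hx : (P.neighborSet x).ncard ≤ 1) (hy : (P.neighborSet y).ncard ≤ 1) :
    ¬ (P.neighborSet z).ncard ≤ 1 := by
  classical
  intro hz
  have := Fintype.ofFinite V
  set C := P.connectedComponentMk x
  have hconn := C.connected_toSimpleGraph
  -- A component on `n` vertices has at least `n - 1` edges, hence degree sum at least `2n - 2`;
  -- three ends would push the sum down to `2n - 3`.
  have hcard := hconn.card_vert_le_card_edgeSet_add_one
  have hdeg (v : C) : C.toSimpleGraph.degree v ≤ (P.neighborSet v).ncard := by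
    rw [← SimpleGraph.card_neighborSet_eq_degree, ← Nat.card_eq_fintype_card, Nat.card_coe_set_eq,
      ← Set.ncard_image_of_injective _ Subtype.val_injective]
    refine Set.ncard_le_ncard ?_ (Set.toFinite _)
    rintro _ ⟨w, hw, rfl⟩
    exact hw
  have hsum := C.toSimpleGraph.sum_degrees_eq_twice_card_edges
  let x' : C := ⟨x, rfl⟩
  let y' : C := ⟨y, (SimpleGraph.ConnectedComponent.sound hxy).symm⟩
  let z' : C := ⟨z, (SimpleGraph.ConnectedComponent.sound hxz).symm⟩
  have hle : ∑ v, C.toSimpleGraph.degree v + ∑ v : C, (if v ∈ ({x', y', z'} : Finset C) then 1 else 0) ≤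
      ∑ v : C, 2 := by
    rw [← Finset.sum_add_distrib]
    refine Finset.sum_le_sum fun v _ => ?_
    have h1 := hdeg v
    have h3 := h2 v
    split_ifs with hv
    · simp only [Finset.mem_insert, Finset.mem_singleton] at hv
      rcases hv with rfl | rfl | rfl
      · have := h1.trans hx; omega
      · have := h1.trans hy; omega
      · have := h1.trans hz; omega
    · omega
  rw [Finset.sum_ite_mem, Finset.univ_inter, Finset.sum_const, Finset.sum_const,
    Finset.card_eq_three.2 ⟨x', y', z', Subtype.ext_iff.not.2 hne, Subtype.ext_iff.not.2 hne',
      Subtype.ext_iff.not.2 hne'', rfl⟩, hsum] at hle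
  rw [Nat.card_eq_fintype_card, Nat.card_eq_fintype_card, ← SimpleGraph.edgeFinset_card] at hcard
  simp only [smul_eq_mul, Finset.card_univ] at hle
  omega


/-- The graph formed by the edges of colors `a` and `b` whose ends are not ends of `e`. -/
def kempeGraph {V : Type*} (e : Sym2 V) (c : V → V → Klein) (a b : Klein) : SimpleGraph V :=
  SimpleGraph.fromRel fun x y => x ∉ e ∧ y ∉ e ∧ (c x y = a ∨ c x y = b)

open Classical in
/-- The result of exchanging the colors `a` and `b` along the Kempe chain that contains the
vertex `t`. -/
noncomputable def kempeSwitch {V : Type*} (e : Sym2 V) (a b : Klein) (t : V) (c : V → V → Klein)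
    (x y : V) : Klein :=
  if (kempeGraph e c a b).Reachable t x ∨ (kempeGraph e c a b).Reachable t y then
    Equiv.swap a b (c x y) else c x y

section

variable {V : Type*} {G : SimpleGraph V} {e : Sym2 V} {c : V → V → Klein} {a b : Klein} {t : V}

theorem IsPartialColoring.kempeGraph_adj (hc : IsPartialColoring G e c) (ha : a ≠ 0)
    (hb : b ≠ 0) {x y : V} :
    (kempeGraph e c a b).Adj x y ↔ x ∉ e ∧ y ∉ e ∧ (c x y = a ∨ c x y = b) := by
  have h := hc.apply_self x
  have := hc.symm x y
  simp only [kempeGraph, SimpleGraph.fromRel_adj]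
  grind

theorem IsPartialColoring.notMem_of_reachable (hc : IsPartialColoring G e c) (ha : a ≠ 0)
    (hb : b ≠ 0) (ht : t ∉ e) {x : V} (h : (kempeGraph e c a b).Reachable t x) : x ∉ e := by
  obtain ⟨w⟩ := h.symm
  cases w with
  | nil => exact ht
  | cons h _ => exact ((hc.kempeGraph_adj ha hb).1 h).1

/-- Exchanging `a` and `b` does not alter which edges have one of these colors, so the chains
survive; this makes the switch an involution. -/
theorem kempeGraph_kempeSwitch : kempeGraph e (kempeSwitch e a b t c) a b = kempeGraph e c a b := by
  have key (x y) : (kempeSwitch e a b t c x y = a ∨ kempeSwitch e a b t c x y = b) ↔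
      (c x y = a ∨ c x y = b) := by
    unfold kempeSwitch
    split_ifs
    · rw [Equiv.swap_apply_eq_iff, Equiv.swap_apply_eq_iff, Equiv.swap_apply_left,
        Equiv.swap_apply_right, or_comm]
    · rfl
  unfold kempeGraph
  simp only [key]

theorem kempeSwitch_kempeSwitch : kempeSwitch e a b t (kempeSwitch e a b t c) = c := by
  funext x y
  rw [kempeSwitch, kempeGraph_kempeSwitch, kempeSwitch]
  split_ifs
  · rw [Equiv.swap_apply_self]
  · rfl

/-- The definition also exchanges colors on edges with a single end on the chain. If the other end
is off the chain and not an end of `e`, such an edge has neither color, so nothing happens to it. -/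
theorem IsPartialColoring.kempeSwitch_of_not_reachable (hc : IsPartialColoring G e c) (ha : a ≠ 0)
    (hb : b ≠ 0) (ht : t ∉ e) {x : V} (hx : x ∉ e) (h : ¬ (kempeGraph e c a b).Reachable t x)
    (y : V) : kempeSwitch e a b t c x y = c x y := by
  unfold kempeSwitch
  split_ifs with h'
  · have hy := h'.resolve_left h
    have hxy : ¬ (c x y = a ∨ c x y = b) := fun hab => h <| hy.trans <| SimpleGraph.Adj.reachable <|
      SimpleGraph.Adj.symm <| (hc.kempeGraph_adj ha hb).2
        ⟨hx, hc.notMem_of_reachable ha hb ht hy, hab⟩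
    rw [not_or] at hxy
    exact Equiv.swap_apply_of_ne_of_ne hxy.1 hxy.2
  · rfl

/-- At a vertex that is not an end of `e`, either all entries of the row are permuted or none is, so
properness persists there. -/
theorem IsPartialColoring.kempeSwitch (hc : IsPartialColoring G e c) (ha : a ≠ 0)
    (hb : b ≠ 0) (ht : t ∉ e) : IsPartialColoring G e (kempeSwitch e a b t c) := by
  refine ⟨fun x y => ?_, fun x y => ?_, fun x hx y z => ?_⟩
  · unfold Snark.kempeSwitch
    rw [hc.symm x y]
    congr 1
    exact propext or_comm
  · rw [← hc.ne_zero_iff]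
    unfold Snark.kempeSwitch
    split_ifs
    · rw [ne_eq, Equiv.swap_apply_eq_iff, Equiv.swap_apply_of_ne_of_ne ha.symm hb.symm]
    · rfl
  · by_cases h : (kempeGraph e c a b).Reachable t x
    · simp only [Snark.kempeSwitch, h, true_or, if_true, EmbeddingLike.apply_eq_iff_eq]
      rw [ne_eq, Equiv.swap_apply_eq_iff, Equiv.swap_apply_of_ne_of_ne ha.symm hb.symm]
      exact hc.proper x hx y z
    · simp only [hc.kempeSwitch_of_not_reachable ha hb ht hx h]
      exact hc.proper x hx y z

theorem IsPartialColoring.ncard_kempeGraph_le_two (hc : IsPartialColoring G e c) (ha : a ≠ 0)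
    (hb : b ≠ 0) (x : V) : ((kempeGraph e c a b).neighborSet x).ncard ≤ 2 := by
  refine (Set.ncard_le_ncard_of_injOn (t := {a, b}) (c x) ?_ ?_).trans (Set.ncard_insert_le _ _) |>.trans ?_
  · intro y hy
    exact ((hc.kempeGraph_adj ha hb).1 hy).2.2
  · intro y hy z hz h
    have h1 := (hc.kempeGraph_adj ha hb).1 hy
    exact hc.proper x h1.1 _ _ (by grind) h
  · simp

/-- An edge of color `a` or `b` that joins `x` to an end of `e` makes `x` an end of its Kempe
chain. -/
theorem IsPartialColoring.ncard_kempeGraph_le_one (hc : IsPartialColoring G e c) (ha : a ≠ 0)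
    (hb : b ≠ 0) {p x : V} (hp : p ∈ e) (hpx : c p x = a ∨ c p x = b) :
    ((kempeGraph e c a b).neighborSet x).ncard ≤ 1 := by
  have h0 : c x p = a ∨ c x p = b := by rwa [hc.symm]
  have key : ∀ y z, y ∈ (kempeGraph e c a b).neighborSet x →
      z ∈ (kempeGraph e c a b).neighborSet x → y = z := by
    intro y z hy hz
    obtain ⟨hx, hy1, hy2⟩ := (hc.kempeGraph_adj ha hb).1 hy
    obtain ⟨-, hz1, hz2⟩ := (hc.kempeGraph_adj ha hb).1 hz
    have h1 := hc.proper x hx p y (by grind)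
    have h2 := hc.proper x hx p z (by grind)
    have h3 := hc.proper x hx y z (by grind)
    grind
  by_cases h : ((kempeGraph e c a b).neighborSet x).Nonempty
  · obtain ⟨y, hy⟩ := h
    have : (kempeGraph e c a b).neighborSet x ⊆ {y} := fun z hz => key z y hz hy
    exact (Set.ncard_le_ncard this).trans (by simp)
  · rw [Set.not_nonempty_iff_eq_empty.1 h]; simp

end

/-- Switching a Kempe chain that ends at a neighbor of `p` changes the color at `p` only. -/
theorem IsSplitColoring.kempeSwitch_apply {V : Type*} [Finite V] {G : SimpleGraph V}
    (hG : IsCubic G) (hg : 5 ≤ G.egirth) (hcol : ¬ G.lineGraph.Colorable 3) {p q : V}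
    (hpq : G.Adj p q) {c : V → V → Klein} (hc : IsSplitColoring G s(p, q) c) {a b : Klein}
    (ha : a ≠ 0) (hb : b ≠ 0) (hab : a ≠ b) {t w : V} (htq : t ≠ q) (hpt : G.Adj p t)
    (hwp : w ≠ p) (hqw : G.Adj q w) (hct : c p t = a) :
    IsSplitColoring G s(p, q) (kempeSwitch s(p, q) a b t c) ∧
      kempeSwitch s(p, q) a b t c p t = b ∧ kempeSwitch s(p, q) a b t c q w = c q w := by
  obtain ⟨h3, h4⟩ := five_le_egirth_iff.1 hg
  have hne := hpq.ne
  have ht : t ∉ s(p, q) := by simp [htq, hpt.ne']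
  have hw : w ∉ s(p, q) := by simp [hwp, hqw.ne']
  have hsw := hc.kempeSwitch (t := t) ha hb ht
  have hsw' := hsw.isSplitColoring hG hcol hpq
  have hpt' : kempeSwitch s(p, q) a b t c p t = b := by
    simp [kempeSwitch, hct]
  refine ⟨hsw', hpt', ?_⟩
  by_cases hr : (kempeGraph s(p, q) c a b).Reachable t w
  swap
  · rw [hsw.symm, hc.symm q]
    exact hc.kempeSwitch_of_not_reachable ha hb ht hw hr _
  by_cases hcw : c q w = a ∨ c q w = b
  swap
  · rw [not_or] at hcw
    unfold kempeSwitch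
    split_ifs
    · rw [Equiv.swap_apply_of_ne_of_ne hcw.1 hcw.2]
    · rfl
  -- Let `t'` be the other neighbor of `p`. By parity the switched coloring is still split, so the
  -- color of `pt'` has changed as well and `t'` is on the chain. Then `t`, `t'` and `w` are three
  -- ends of one chain.
  exfalso
  obtain ⟨t', h1, h2, -⟩ := hG.exists_removeEdge_adj (Sym2.mem_mk_left p q) ht hpt
  have hct' : c p t' = a := by
    rw [← hct]
    have htp' : t'.1 ≠ q := fun h => t'.2 (by simp [h])
    exact hc.ends p (by simp) _ _ (hc.end_ne_zero htp' h2) (hct.trans_ne ha)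
  have hpt'' : kempeSwitch s(p, q) a b t c p t' = b := by
    have htp' : t'.1 ≠ q := fun h => t'.2 (by simp [h])
    refine Eq.trans ?_ hpt'
    exact hsw'.ends p (by simp) _ _ (hsw.end_ne_zero htp' h2) (hpt'.trans_ne hb)
  have hr' : (kempeGraph s(p, q) c a b).Reachable t t' := by
    by_contra hr'
    rw [hsw.symm, hc.kempeSwitch_of_not_reachable ha hb ht t'.2 hr', hc.symm, hct'] at hpt''
    exact hab hpt''
  refine not_three_ends (hc.ncard_kempeGraph_le_two ha hb) hr' hr h1.symm ?_ ?_
    (hc.ncard_kempeGraph_le_one ha hb (Sym2.mem_mk_left p q) (Or.inl hct))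
    (hc.ncard_kempeGraph_le_one ha hb (Sym2.mem_mk_left p q) (Or.inl hct'))
    (hc.ncard_kempeGraph_le_one ha hb (Sym2.mem_mk_right p q) hcw)
  · rintro rfl
    exact h3 _ _ _ hpt hqw.symm hpq.symm
  · intro h
    rw [h] at h2
    exact h3 _ _ _ h2 hqw.symm hpq.symm

/-- The switch from `a` to `b` at `t` is an involution, hence injective. -/
theorem card_splitColoring_le {V : Type*} [Finite V] {G : SimpleGraph V}
    (hG : IsCubic G) (hg : 5 ≤ G.egirth) (hcol : ¬ G.lineGraph.Colorable 3) {p q : V}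
    (hpq : G.Adj p q) {t w : V} (htq : t ≠ q) (hpt : G.Adj p t)
    (hwp : w ≠ p) (hqw : G.Adj q w) {a b : Klein} (ha : a ≠ 0) (hb : b ≠ 0) (k : Klein) :
    Nat.card {c // IsSplitColoring G s(p, q) c ∧ c p t = a ∧ c q w = k} ≤
      Nat.card {c // IsSplitColoring G s(p, q) c ∧ c p t = b ∧ c q w = k} := by
  by_cases hab : a = b
  · rw [hab]
  refine Nat.card_le_card_of_injective (fun c => ⟨kempeSwitch s(p, q) a b t c.1, ?_⟩) ?_
  · obtain ⟨h1, h2, h3⟩ := c.2.1.kempeSwitch_apply hG hg hcol hpq ha hb hab htq hpt hwp hqw c.2.2.1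
    exact ⟨h1, h2, h3.trans c.2.2.2⟩
  · intro c d h
    have := congrArg (fun f => kempeSwitch s(p, q) a b t f.1) h
    simp only [kempeSwitch_kempeSwitch] at this
    exact Subtype.ext this

/-- In a snark, the colors of the two new edges of `removeEdge G s(p, q)` are equidistributed. -/
theorem card_splitColoring_eq {V : Type*} [Finite V] {G : SimpleGraph V}
    (hG : IsCubic G) (hg : 5 ≤ G.egirth) (hcol : ¬ G.lineGraph.Colorable 3) {p q : V}
    (hpq : G.Adj p q) {t w : V} (htq : t ≠ q) (hpt : G.Adj p t)
    (hwp : w ≠ p) (hqw : G.Adj q w) {a b : Klein} (ha : a ≠ 0) (hb : b ≠ 0) :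
    9 * Nat.card {c // IsSplitColoring G s(p, q) c ∧ c p t = a ∧ c q w = b} =
      Nat.card {c // IsSplitColoring G s(p, q) c} := by
  have h1 {a b k : Klein} (ha : a ≠ 0) (hb : b ≠ 0) :
      Nat.card {c // IsSplitColoring G s(p, q) c ∧ c p t = a ∧ c q w = k} =
      Nat.card {c // IsSplitColoring G s(p, q) c ∧ c p t = b ∧ c q w = k} :=
    (card_splitColoring_le hG hg hcol hpq htq hpt hwp hqw ha hb k).antisymm
      (card_splitColoring_le hG hg hcol hpq htq hpt hwp hqw hb ha k)
  -- The same inequality with the roles of `p` and `q` exchanged.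
  have h2 {a b k : Klein} (ha : a ≠ 0) (hb : b ≠ 0) :
      Nat.card {c // IsSplitColoring G s(p, q) c ∧ c p t = k ∧ c q w = a} =
      Nat.card {c // IsSplitColoring G s(p, q) c ∧ c p t = k ∧ c q w = b} := by
    simp only [Sym2.eq_swap (a := p), and_comm (b := _ = a), and_comm (b := _ = b)]
    exact (card_splitColoring_le hG hg hcol hpq.symm hwp hqw htq hpt ha hb k).antisymm
      (card_splitColoring_le hG hg hcol hpq.symm hwp hqw htq hpt hb ha k)
  -- There are `3 * 3` pairs of colors, and all fibers have the same size.
  let F : {c // IsSplitColoring G s(p, q) c} → {k : Klein // k ≠ 0} × {k : Klein // k ≠ 0} :=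
    fun c => (⟨c.1 p t, c.2.end_ne_zero htq hpt⟩, ⟨c.1 q w, c.2.end_ne_zero' hwp hqw⟩)
  have hF (k) : Nat.card {c // F c = k} =
      Nat.card {c // IsSplitColoring G s(p, q) c ∧ c p t = a ∧ c q w = b} := by
    rw [h1 ha k.1.2, h2 hb k.2.2]
    refine Nat.card_congr ((Equiv.subtypeEquivRight ?_).trans
      (Equiv.subtypeSubtypeEquivSubtypeInter _ (fun c : V → V → Klein => c p t = k.1.1 ∧ c q w = k.2.1)))
    intro c
    simp [F, Prod.ext_iff, Subtype.ext_iff]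
  rw [← Nat.card_congr (Equiv.sigmaFiberEquiv F), Nat.card_sigma]
  simp only [hF]
  rw [Finset.sum_const, Finset.card_univ, ← Nat.card_eq_fintype_card, Nat.card_prod,
    card_nonzero_klein, smul_eq_mul]

/-! ### Adjacency in the superposition and its two projections -/

namespace SuperpositionData

variable {α β : Type*} {G' : SimpleGraph α} {Gs : SimpleGraph β} (K : SuperpositionData G' Gs)

section adjacency

variable {x y : ({K.U, K.V}ᶜ : Set α)} {z w : ({K.u, K.v}ᶜ : Set β)} {i j : Fin 3}

theorem graph_adj_iff {a b : K.Vertex} : K.graph.Adj a b ↔ a ≠ b ∧ (K.Rel a b ∨ K.Rel b a) :=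
  SimpleGraph.fromRel_adj _ _ _

theorem adj_base_base : K.graph.Adj (.base x) (.base y) ↔ G'.Adj x y := by
  have : G'.Adj x y → x ≠ y := fun h h' => h.ne (congrArg _ h')
  simp only [graph_adj_iff, Rel, G'.adj_comm y x]
  grind

theorem adj_inner_inner : K.graph.Adj (.inner z) (.inner w) ↔ Gs.Adj z w := by
  have : Gs.Adj z w → z ≠ w := fun h h' => h.ne (congrArg _ h')
  simp only [graph_adj_iff, Rel, Gs.adj_comm w z]
  grind

theorem adj_T_T : K.graph.Adj (.T i) (.T j) ↔ (i : ℕ) + 1 = j ∨ (j : ℕ) + 1 = i := by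
  simp only [graph_adj_iff, Rel]
  grind

theorem adj_W_W : K.graph.Adj (.W i) (.W j) ↔ (i : ℕ) + 1 = j ∨ (j : ℕ) + 1 = i := by
  simp only [graph_adj_iff, Rel]
  grind

theorem adj_T_base : K.graph.Adj (.T i) (.base x) ↔
    (i = 0 ∧ (x : α) = K.Tneg) ∨ (i = 2 ∧ (x : α) = K.Tpos) := by
  simp [graph_adj_iff, Rel]

theorem adj_base_T : K.graph.Adj (.base x) (.T i) ↔
    (i = 0 ∧ (x : α) = K.Tneg) ∨ (i = 2 ∧ (x : α) = K.Tpos) := by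
  simp [graph_adj_iff, Rel]

theorem adj_W_base : K.graph.Adj (.W i) (.base x) ↔
    (i = 0 ∧ (x : α) = K.Wneg) ∨ (i = 2 ∧ (x : α) = K.Wpos) := by
  simp [graph_adj_iff, Rel]

theorem adj_base_W : K.graph.Adj (.base x) (.W i) ↔
    (i = 0 ∧ (x : α) = K.Wneg) ∨ (i = 2 ∧ (x : α) = K.Wpos) := by
  simp [graph_adj_iff, Rel]

theorem adj_T_inner : K.graph.Adj (.T i) (.inner z) ↔ (z : β) = K.us i := by
  simp [graph_adj_iff, Rel]

theorem adj_inner_T : K.graph.Adj (.inner z) (.T i) ↔ (z : β) = K.us i := by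
  simp [graph_adj_iff, Rel]

theorem adj_W_inner : K.graph.Adj (.W i) (.inner z) ↔ (z : β) = K.vs i := by
  simp [graph_adj_iff, Rel]

theorem adj_inner_W : K.graph.Adj (.inner z) (.W i) ↔ (z : β) = K.vs i := by
  simp [graph_adj_iff, Rel]

theorem not_adj_T_W : ¬ K.graph.Adj (.T i) (.W j) := by simp [graph_adj_iff, Rel]

theorem not_adj_W_T : ¬ K.graph.Adj (.W i) (.T j) := by simp [graph_adj_iff, Rel]

theorem not_adj_base_inner : ¬ K.graph.Adj (.base x) (.inner z) := by simp [graph_adj_iff, Rel]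

theorem not_adj_inner_base : ¬ K.graph.Adj (.inner z) (.base x) := by simp [graph_adj_iff, Rel]

end adjacency

theorem adj_U_iff (y : α) : G'.Adj K.U y ↔ y = K.V ∨ y = K.Tneg ∨ y = K.Tpos := by
  rw [← SimpleGraph.mem_neighborSet, K.neighbors_U]; simp

theorem adj_V_iff (y : α) : G'.Adj K.V y ↔ y = K.U ∨ y = K.Wneg ∨ y = K.Wpos := by
  rw [← SimpleGraph.mem_neighborSet, K.neighbors_V]; simp

theorem adj_u_iff (y : β) : Gs.Adj K.u y ↔ ∃ i, y = K.us i := by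
  rw [← SimpleGraph.mem_neighborSet, K.neighbors_u]; simp [eq_comm]

theorem adj_v_iff (y : β) : Gs.Adj K.v y ↔ ∃ i, y = K.vs i := by
  rw [← SimpleGraph.mem_neighborSet, K.neighbors_v]; simp [eq_comm]

theorem pairwise_ne_of_ncard {γ : Type*} {a b c : γ} (h : ({a, b, c} : Set γ).ncard = 3) :
    a ≠ b ∧ a ≠ c ∧ b ≠ c := by
  refine ⟨?_, ?_, ?_⟩ <;> rintro rfl
  · have := Set.ncard_insert_le a {c}
    simp at h this
    omega
  · have := Set.ncard_insert_le a {b}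
    rw [Set.insert_comm] at h
    simp at h
    rw [Set.pair_comm] at h
    simp at this
    omega
  · have := Set.ncard_insert_le a {b}
    simp at h this
    omega

theorem injective_of_ncard_range {γ : Type*} {f : Fin 3 → γ} (h : (Set.range f).ncard = 3) :
    Function.Injective f := by
  rw [← Set.image_univ] at h
  exact Set.injOn_univ.1 (Set.injOn_of_ncard_image_eq (by rw [h, Set.ncard_univ]; simp))

/-- What cubicity and the girth condition say about the vertices of the data. -/
structure Distinct : Prop where
  U_ne_V : K.U ≠ K.V
  Tneg_ne_U : K.Tneg ≠ K.U
  Tneg_ne_V : K.Tneg ≠ K.V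
  Tpos_ne_U : K.Tpos ≠ K.U
  Tpos_ne_V : K.Tpos ≠ K.V
  Wneg_ne_U : K.Wneg ≠ K.U
  Wneg_ne_V : K.Wneg ≠ K.V
  Wpos_ne_U : K.Wpos ≠ K.U
  Wpos_ne_V : K.Wpos ≠ K.V
  Tneg_ne_Tpos : K.Tneg ≠ K.Tpos
  Wneg_ne_Wpos : K.Wneg ≠ K.Wpos
  Tneg_ne_Wneg : K.Tneg ≠ K.Wneg
  Tneg_ne_Wpos : K.Tneg ≠ K.Wpos
  Tpos_ne_Wneg : K.Tpos ≠ K.Wneg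
  Tpos_ne_Wpos : K.Tpos ≠ K.Wpos
  us_injective : Function.Injective K.us
  vs_injective : Function.Injective K.vs
  us_ne_u : ∀ i, K.us i ≠ K.u
  us_ne_v : ∀ i, K.us i ≠ K.v
  vs_ne_u : ∀ i, K.vs i ≠ K.u
  vs_ne_v : ∀ i, K.vs i ≠ K.v

/-- A common neighbor of `U` and `V` would form a triangle with them, and `u`, `v` are nonadjacent.
A coincidence `us i = vs j` is not excluded. -/
theorem distinct (hG' : IsCubic G') (hg' : 5 ≤ G'.egirth) (hGs : IsCubic Gs) : K.Distinct := by
  obtain ⟨h3, -⟩ := five_le_egirth_iff.1 hg'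
  have hU := hG' K.U
  have hV := hG' K.V
  rw [K.neighbors_U] at hU
  rw [K.neighbors_V] at hV
  obtain ⟨h1, h2, h5⟩ := pairwise_ne_of_ncard hU
  obtain ⟨h1', h2', h5'⟩ := pairwise_ne_of_ncard hV
  have hT := (K.adj_U_iff K.Tneg).2 (by simp)
  have hT' := (K.adj_U_iff K.Tpos).2 (by simp)
  have hW := (K.adj_V_iff K.Wneg).2 (by simp)
  have hW' := (K.adj_V_iff K.Wpos).2 (by simp)
  have htri {x y : α} (hx : G'.Adj K.U x) (hy : G'.Adj K.V y) : x ≠ y := by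
    rintro rfl
    exact h3 _ _ _ hx hy.symm K.adj_UV.symm
  have hu (i) : Gs.Adj K.u (K.us i) := (K.adj_u_iff _).2 ⟨i, rfl⟩
  have hv (i) : Gs.Adj K.v (K.vs i) := (K.adj_v_iff _).2 ⟨i, rfl⟩
  have hu3 := hGs K.u
  have hv3 := hGs K.v
  rw [K.neighbors_u] at hu3
  rw [K.neighbors_v] at hv3
  exact ⟨K.adj_UV.ne, hT.ne', h1.symm, hT'.ne', h2.symm, h1'.symm, hW.ne', h2'.symm, hW'.ne', h5,
    h5', htri hT hW, htri hT hW', htri hT' hW, htri hT' hW', injective_of_ncard_range hu3,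
    injective_of_ncard_range hv3, fun i => (hu i).ne',
    fun i h => K.not_adj_uv (h ▸ hu i), fun i h => K.not_adj_uv (h ▸ hv i).symm,
    fun i => (hv i).ne'⟩

/-- The projection of the superposition to `G'`; its values at the vertices of `G*` do not
matter. -/
def outer : K.Vertex → α
  | .base x => x
  | .inner _ => K.U
  | .T _ => K.U
  | .W _ => K.V

/-- The projection of the superposition to `G*`; its values at the vertices of `G'` do not
matter. -/
def inside : K.Vertex → β
  | .base _ => K.u
  | .inner y => y
  | .T _ => K.u
  | .W _ => K.v

theorem base_ne (x : ({K.U, K.V}ᶜ : Set α)) : x.1 ≠ K.U ∧ x.1 ≠ K.V := by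
  obtain ⟨x, hx⟩ := x
  simpa using hx

theorem inner_ne (x : ({K.u, K.v}ᶜ : Set β)) : x.1 ≠ K.u ∧ x.1 ≠ K.v := by
  obtain ⟨x, hx⟩ := x
  simpa using hx

variable {K}

/-- Near a vertex of `G' - {U, V}` the superposition looks like `G'`: no such vertex meets both ends
of a strand, because `Tneg ≠ Tpos` and `Wneg ≠ Wpos`. Degrees and properness are carried over by
this bijection. -/
theorem Distinct.bijOn_outer (hK : K.Distinct) (x : ({K.U, K.V}ᶜ : Set α)) :
    Set.BijOn K.outer (K.graph.neighborSet (.base x)) (G'.neighborSet x) := by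
  obtain ⟨x, hx⟩ := x
  have hx' : x ≠ K.U ∧ x ≠ K.V := by simpa using hx
  have hbase := K.base_ne
  have hU := K.adj_U_iff x
  have hV := K.adj_V_iff x
  have hUV := K.adj_UV.ne
  have := hK.Tneg_ne_Tpos
  have := hK.Wneg_ne_Wpos
  have hadj := G'.adj_comm x
  refine ⟨?_, ?_, ?_⟩
  · rintro (y | y | i | i) hy <;> simp only [SimpleGraph.mem_neighborSet, adj_base_base, adj_base_T,
      adj_base_W, not_adj_base_inner] at hy
    · exact hy
    · simp only [outer, SimpleGraph.mem_neighborSet]; grind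
    · simp only [outer, SimpleGraph.mem_neighborSet]; grind
  · rintro (y | y | i | i) h (z | z | j | j) h' <;> simp only [SimpleGraph.mem_neighborSet,
      adj_base_base, adj_base_T, adj_base_W, not_adj_base_inner] at h h' <;>
      simp only [outer, Vertex.base.injEq, Vertex.T.injEq, Vertex.W.injEq, reduceCtorEq,
        Subtype.ext_iff] <;> grind
  · intro y hy
    rw [SimpleGraph.mem_neighborSet] at hy
    by_cases h1 : y = K.U
    · subst h1
      rcases hU.1 hy.symm with h | h | h
      · grind
      · exact ⟨.T 0, K.adj_base_T.2 (by simp [h]), rfl⟩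
      · exact ⟨.T 2, K.adj_base_T.2 (by simp [h]), rfl⟩
    · by_cases h2 : y = K.V
      · subst h2
        rcases hV.1 hy.symm with h | h | h
        · grind
        · exact ⟨.W 0, K.adj_base_W.2 (by simp [h]), rfl⟩
        · exact ⟨.W 2, K.adj_base_W.2 (by simp [h]), rfl⟩
      · exact ⟨.base ⟨y, by simp [h1, h2]⟩, K.adj_base_base.2 hy, rfl⟩

theorem Distinct.bijOn_inside (hK : K.Distinct) (x : ({K.u, K.v}ᶜ : Set β)) :
    Set.BijOn K.inside (K.graph.neighborSet (.inner x)) (Gs.neighborSet x) := by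
  obtain ⟨x, hx⟩ := x
  have hx' : x ≠ K.u ∧ x ≠ K.v := by simpa using hx
  have hinner := K.inner_ne
  have hu := K.adj_u_iff x
  have hv := K.adj_v_iff x
  have huv := K.u_ne_v
  have h1 := hK.us_injective
  have h2 := hK.vs_injective
  have hadj := Gs.adj_comm x
  refine ⟨?_, ?_, ?_⟩
  · rintro (y | y | i | i) hy <;> simp only [SimpleGraph.mem_neighborSet, adj_inner_inner,
      adj_inner_T, adj_inner_W, not_adj_inner_base] at hy
    · exact hy
    · simp only [inside, SimpleGraph.mem_neighborSet]; grind
    · simp only [inside, SimpleGraph.mem_neighborSet]; grind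
  · rintro (y | y | i | i) h (z | z | j | j) h' <;> simp only [SimpleGraph.mem_neighborSet,
      adj_inner_inner, adj_inner_T, adj_inner_W, not_adj_inner_base] at h h' <;>
      simp only [inside, Vertex.inner.injEq, Vertex.T.injEq, Vertex.W.injEq, reduceCtorEq,
        Subtype.ext_iff] <;>
      grind
  · intro y hy
    rw [SimpleGraph.mem_neighborSet] at hy
    by_cases h1 : y = K.u
    · subst h1
      obtain ⟨i, h⟩ := hu.1 hy.symm
      exact ⟨.T i, K.adj_inner_T.2 h, rfl⟩
    · by_cases h2 : y = K.v
      · subst h2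
        obtain ⟨i, h⟩ := hv.1 hy.symm
        exact ⟨.W i, K.adj_inner_W.2 h, rfl⟩
      · exact ⟨.inner ⟨y, by simp [h1, h2]⟩, K.adj_inner_inner.2 hy, rfl⟩

end SuperpositionData
-- The superposition is cubic of girth at least 5
namespace SuperpositionData

variable {α β : Type*} {G' : SimpleGraph α} {Gs : SimpleGraph β} {K : SuperpositionData G' Gs}

theorem Distinct.isCubic [Finite α] [Finite β] (hK : K.Distinct) (hG' : IsCubic G')
    (hGs : IsCubic Gs) : IsCubic K.graph := by
  rintro (x | y | i | i)
  · have h := hK.bijOn_outer x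
    rw [← hG' x, ← h.image_eq, h.injOn.ncard_image]
  · have h := hK.bijOn_inside y
    rw [← hGs y, ← h.image_eq, h.injOn.ncard_image]
  · have hT : K.Tneg ∈ ({K.U, K.V}ᶜ : Set α) := by simp [hK.Tneg_ne_U, hK.Tneg_ne_V]
    have hT' : K.Tpos ∈ ({K.U, K.V}ᶜ : Set α) := by simp [hK.Tpos_ne_U, hK.Tpos_ne_V]
    have hu : K.us i ∈ ({K.u, K.v}ᶜ : Set β) := by simp [hK.us_ne_u, hK.us_ne_v]
    rw [Set.ncard_eq_three]
    have hi : i = 0 ∨ i = 1 ∨ i = 2 := by omega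
    rcases hi with rfl | rfl | rfl
    · refine ⟨.base ⟨_, hT⟩, .T 1, .inner ⟨_, hu⟩, by simp, by simp, by simp, ?_⟩
      ext (x | x | j | j) <;> simp [adj_T_base, adj_T_T, adj_T_inner, not_adj_T_W, Subtype.ext_iff]
      grind
    · refine ⟨.T 0, .T 2, .inner ⟨_, hu⟩, by simp, by simp, by simp, ?_⟩
      ext (x | x | j | j) <;> simp [adj_T_base, adj_T_T, adj_T_inner, not_adj_T_W, Subtype.ext_iff]
      grind
    · refine ⟨.base ⟨_, hT'⟩, .T 1, .inner ⟨_, hu⟩, by simp, by simp, by simp, ?_⟩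
      ext (x | x | j | j) <;> simp [adj_T_base, adj_T_T, adj_T_inner, not_adj_T_W, Subtype.ext_iff]
      grind
  · have hT : K.Wneg ∈ ({K.U, K.V}ᶜ : Set α) := by simp [hK.Wneg_ne_U, hK.Wneg_ne_V]
    have hT' : K.Wpos ∈ ({K.U, K.V}ᶜ : Set α) := by simp [hK.Wpos_ne_U, hK.Wpos_ne_V]
    have hu : K.vs i ∈ ({K.u, K.v}ᶜ : Set β) := by simp [hK.vs_ne_u, hK.vs_ne_v]
    rw [Set.ncard_eq_three]
    have hi : i = 0 ∨ i = 1 ∨ i = 2 := by omega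
    rcases hi with rfl | rfl | rfl
    · refine ⟨.base ⟨_, hT⟩, .W 1, .inner ⟨_, hu⟩, by simp, by simp, by simp, ?_⟩
      ext (x | x | j | j) <;> simp [adj_W_base, adj_W_W, adj_W_inner, not_adj_W_T, Subtype.ext_iff]
      grind
    · refine ⟨.W 0, .W 2, .inner ⟨_, hu⟩, by simp, by simp, by simp, ?_⟩
      ext (x | x | j | j) <;> simp [adj_W_base, adj_W_W, adj_W_inner, not_adj_W_T, Subtype.ext_iff]
      grind
    · refine ⟨.base ⟨_, hT'⟩, .W 1, .inner ⟨_, hu⟩, by simp, by simp, by simp, ?_⟩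
      ext (x | x | j | j) <;> simp [adj_W_base, adj_W_W, adj_W_inner, not_adj_W_T, Subtype.ext_iff]
      grind

section girth

set_option maxHeartbeats 1000000
set_option linter.unusedSimpArgs false

/-- Contracting the strands to `u` and `v` reduces most cases to `G*`. A closed 4-walk that also
visits `G'` either backtracks or passes through a common neighbor of `U` and `V`. -/
theorem Distinct.eq_or_eq_of_inner (hK : K.Distinct) (hgs : 5 ≤ Gs.egirth)
    (x : ({K.u, K.v}ᶜ : Set β)) (y z w : K.Vertex) (hxy : K.graph.Adj (.inner x) y)
    (hyz : K.graph.Adj y z) (hzw : K.graph.Adj z w) (hwx : K.graph.Adj w (.inner x)) :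
    .inner x = z ∨ y = w := by
  obtain ⟨h3, h4⟩ := five_le_egirth_iff.1 hgs
  have hu (i) : Gs.Adj K.u (K.us i) := (K.adj_u_iff _).2 ⟨i, rfl⟩
  have hv (i) : Gs.Adj K.v (K.vs i) := (K.adj_v_iff _).2 ⟨i, rfl⟩
  have n3 := hK.Tneg_ne_Wneg
  have n4 := hK.Tneg_ne_Wpos
  have n5 := hK.Tpos_ne_Wneg
  have n6 := hK.Tpos_ne_Wpos
  have n7 : ∀ i j, K.us i = K.us j → i = j := hK.us_injective
  have n8 : ∀ i j, K.vs i = K.vs j → i = j := hK.vs_injective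
  have m3 (i j) : ¬ Gs.Adj (K.us i) (K.us j) := fun h => h3 _ _ _ (hu i) h (hu j).symm
  have m4 (i j) : ¬ Gs.Adj (K.vs i) (K.vs j) := fun h => h3 _ _ _ (hv i) h (hv j).symm
  have b2 := K.inner_ne
  have s2 := Gs.adj_comm
  revert hxy hyz hzw hwx
  rcases y with y | y | j | j <;> rcases z with z | z | k | k <;> rcases w with w | w | l | l <;>
    simp only [adj_base_base, adj_inner_inner, adj_T_T, adj_W_W, adj_T_base, adj_base_T,
        adj_W_base, adj_base_W, adj_T_inner, adj_inner_T, adj_W_inner, adj_inner_W, not_adj_T_W,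
        not_adj_W_T, not_adj_base_inner, not_adj_inner_base, false_imp_iff, imp_true_iff,
        Vertex.base.injEq, Vertex.inner.injEq, Vertex.T.injEq, Vertex.W.injEq, Subtype.ext_iff,
        reduceCtorEq, or_false, false_or, or_self] <;>
    grind

/-- The case of an opposite vertex in `G*` is left open, since `Distinct.eq_or_eq_of_inner` settles
it after a rotation of the walk. -/
theorem Distinct.eq_or_eq_of_base (hK : K.Distinct) (hg' : 5 ≤ G'.egirth)
    (x : ({K.U, K.V}ᶜ : Set α)) (y z w : K.Vertex) (hxy : K.graph.Adj (.base x) y)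
    (hyz : K.graph.Adj y z) (hzw : K.graph.Adj z w) (hwx : K.graph.Adj w (.base x)) :
    .base x = z ∨ y = w ∨ ∃ z', z = .inner z' := by
  obtain ⟨h3', h4'⟩ := five_le_egirth_iff.1 hg'
  have hT := (K.adj_U_iff K.Tneg).2 (by simp)
  have hT' := (K.adj_U_iff K.Tpos).2 (by simp)
  have hW := (K.adj_V_iff K.Wneg).2 (by simp)
  have hW' := (K.adj_V_iff K.Wpos).2 (by simp)
  have n1 := hK.Tneg_ne_Tpos
  have n2 := hK.Wneg_ne_Wpos
  have n3 := hK.Tneg_ne_Wneg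
  have n4 := hK.Tneg_ne_Wpos
  have n5 := hK.Tpos_ne_Wneg
  have n6 := hK.Tpos_ne_Wpos
  have b1 := K.base_ne
  have s1 := G'.adj_comm
  revert hxy hyz hzw hwx
  rcases y with y | y | j | j <;> rcases z with z | z | k | k <;> rcases w with w | w | l | l <;>
    simp only [adj_base_base, adj_inner_inner, adj_T_T, adj_W_W, adj_T_base, adj_base_T,
        adj_W_base, adj_base_W, adj_T_inner, adj_inner_T, adj_W_inner, adj_inner_W, not_adj_T_W,
        not_adj_W_T, not_adj_base_inner, not_adj_inner_base, false_imp_iff, imp_true_iff,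
        Vertex.base.injEq, Vertex.inner.injEq, Vertex.T.injEq, Vertex.W.injEq, Subtype.ext_iff,
        reduceCtorEq, or_false, false_or, or_self] <;>
    grind

theorem Distinct.five_le_egirth (hK : K.Distinct) (hg' : 5 ≤ G'.egirth) (hgs : 5 ≤ Gs.egirth) :
    5 ≤ K.graph.egirth := by
  rw [five_le_egirth_iff]
  constructor
  · obtain ⟨h3', -⟩ := five_le_egirth_iff.1 hg'
    obtain ⟨h3, -⟩ := five_le_egirth_iff.1 hgs
    have hT := (K.adj_U_iff K.Tneg).2 (by simp)
    have hT' := (K.adj_U_iff K.Tpos).2 (by simp)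
    have hW := (K.adj_V_iff K.Wneg).2 (by simp)
    have hW' := (K.adj_V_iff K.Wpos).2 (by simp)
    have hu (i) : Gs.Adj K.u (K.us i) := (K.adj_u_iff _).2 ⟨i, rfl⟩
    have hv (i) : Gs.Adj K.v (K.vs i) := (K.adj_v_iff _).2 ⟨i, rfl⟩
    have n1 := hK.Tneg_ne_Tpos
    have n2 := hK.Wneg_ne_Wpos
    have n7 : ∀ i j, K.us i = K.us j → i = j := hK.us_injective
    have n8 : ∀ i j, K.vs i = K.vs j → i = j := hK.vs_injective
    have s1 := G'.adj_comm
    have s2 := Gs.adj_comm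
    rintro (x | x | i | i) (y | y | j | j) (z | z | k | k) <;>
      simp only [adj_base_base, adj_inner_inner, adj_T_T, adj_W_W, adj_T_base, adj_base_T,
        adj_W_base, adj_base_W, adj_T_inner, adj_inner_T, adj_W_inner, adj_inner_W, not_adj_T_W,
        not_adj_W_T, not_adj_base_inner, not_adj_inner_base, false_imp_iff, imp_true_iff,
        Vertex.base.injEq, Vertex.inner.injEq, Vertex.T.injEq, Vertex.W.injEq, Subtype.ext_iff,
        reduceCtorEq, or_false, false_or, or_self] <;>
      grind
  · have key (x y z w : K.Vertex) (hxy : K.graph.Adj x y) (hyz : K.graph.Adj y z)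
        (hzw : K.graph.Adj z w) (hwx : K.graph.Adj w x)
        (h : (∃ b, x = .base b) ∨ ∃ b, x = .inner b) : x = z ∨ y = w := by
      obtain ⟨b, rfl⟩ | ⟨b, rfl⟩ := h
      · rcases hK.eq_or_eq_of_base hg' b y z w hxy hyz hzw hwx with h | h | ⟨z', rfl⟩
        · exact Or.inl h
        · exact Or.inr h
        · exact (hK.eq_or_eq_of_inner hgs z' w _ y hzw hwx hxy hyz).imp Eq.symm Eq.symm
      · exact hK.eq_or_eq_of_inner hgs b y z w hxy hyz hzw hwx
    intro x y z w hxy hyz hzw hwx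
    by_cases hx : (∃ b, x = .base b) ∨ ∃ b, x = .inner b
    · exact key x y z w hxy hyz hzw hwx hx
    by_cases hy : (∃ b, y = .base b) ∨ ∃ b, y = .inner b
    · exact ((key y z w x hyz hzw hwx hxy hy).imp id Eq.symm).symm
    by_cases hz : (∃ b, z = .base b) ∨ ∃ b, z = .inner b
    · exact (key z w x y hzw hwx hxy hyz hz).imp Eq.symm Eq.symm
    by_cases hw : (∃ b, w = .base b) ∨ ∃ b, w = .inner b
    · exact ((key w x y z hwx hxy hyz hzw hw).imp Eq.symm id).symm
    -- All four vertices are now on the strands, which are paths on three vertices.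
    revert hxy hyz hzw hwx
    rcases x with x | x | i | i <;> simp only [Vertex.base.injEq, Vertex.inner.injEq, exists_eq', reduceCtorEq, true_or, or_true, not_true] at hx <;>
    rcases y with y | y | j | j <;> simp only [Vertex.base.injEq, Vertex.inner.injEq, exists_eq', reduceCtorEq, true_or, or_true, not_true] at hy <;>
    rcases z with z | z | k | k <;> simp only [Vertex.base.injEq, Vertex.inner.injEq, exists_eq', reduceCtorEq, true_or, or_true, not_true] at hz <;>
    rcases w with w | w | l | l <;> simp only [Vertex.base.injEq, Vertex.inner.injEq, exists_eq', reduceCtorEq, true_or, or_true, not_true] at hw <;>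
      simp only [adj_T_T, adj_W_W, not_adj_T_W, not_adj_W_T, false_imp_iff, imp_true_iff,
        Vertex.T.injEq, Vertex.W.injEq] <;>
      omega

end girth

end SuperpositionData

/-! ### Restricting and gluing matrices -/

theorem IsPartialColoring.eq_zero {V : Type*} {G : SimpleGraph V} {e : Sym2 V}
    {c : V → V → Klein} (hc : IsPartialColoring G e c) {x y : V} (h : ¬ G.Adj x y) : c x y = 0 := by
  by_contra h0
  exact h ((hc.ne_zero_iff x y).1 h0).1

theorem klein_add_add_self (k : Klein) : k + k + k = k := by
  rw [klein_add_self, zero_add]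

namespace SuperpositionData

variable {α β : Type*} {G' : SimpleGraph α} {Gs : SimpleGraph β} (K : SuperpositionData G' Gs)

/-- The colors of the superposition of two matrices at pairs of adjacent vertices. -/
def glueAux (c : α → α → Klein) (d : β → β → Klein) : K.Vertex → K.Vertex → Klein
  | .base x, b => c x (K.outer b)
  | .inner y, b => d y (K.inside b)
  | .T _, .base x => c K.U x
  | .W _, .base x => c K.V x
  | .T _, .inner y => d K.u y
  | .W _, .inner y => d K.v y
  -- For adjacent `i`, `j` in `Fin 3`, `-(i + j)` is the third index: the edge `T i`–`T j` takes the
  -- color found at the remaining strand vertex.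
  | .T i, .T j => d K.u (K.us (-(i + j)))
  | .W i, .W j => d K.v (K.vs (-(i + j)))
  | _, _ => 0

open Classical in
/-- The superposition of a matrix on `G'` and a matrix on `G*`. -/
noncomputable def glue (c : α → α → Klein) (d : β → β → Klein) (a b : K.Vertex) : Klein :=
  if K.graph.Adj a b then K.glueAux c d a b else 0

open Classical in
/-- The vertices of the superposition that lie over a vertex of `G'`; the index matters at `U` and
`V` only. -/
noncomputable def toBase (x : α) (i : Fin 3) : K.Vertex :=
  if hU : x = K.U then .T i else if hV : x = K.V then .W i else .base ⟨x, by simp [hU, hV]⟩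

open Classical in
/-- The vertices of the superposition that lie over a vertex of `G*`; the index matters at `u` and
`v` only. -/
noncomputable def toInner (y : β) (i : Fin 3) : K.Vertex :=
  if hu : y = K.u then .T i else if hv : y = K.v then .W i else .inner ⟨y, by simp [hu, hv]⟩

/-- The restriction to `G'` of a matrix on the superposition. As the entries are of order two, the
sum is the entry itself for two vertices other than `U` and `V`. -/
noncomputable def restrictBase (c : K.Vertex → K.Vertex → Klein) (x y : α) : Klein :=
  ∑ i, c (K.toBase x i) (K.toBase y i)

/-- The restriction to `G*` of a matrix on the superposition. -/
noncomputable def restrictInner (c : K.Vertex → K.Vertex → Klein) (x y : β) : Klein :=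
  ∑ i, c (K.toInner x i) (K.toInner y i)

theorem toBase_U (i : Fin 3) : K.toBase K.U i = .T i := by simp [toBase]

theorem toBase_V (i : Fin 3) : K.toBase K.V i = .W i := by simp [toBase, K.adj_UV.ne']

theorem toBase_base (x : ({K.U, K.V}ᶜ : Set α)) (i : Fin 3) : K.toBase x i = .base x := by
  simp [toBase, K.base_ne x]

theorem toInner_u (i : Fin 3) : K.toInner K.u i = .T i := by simp [toInner]

theorem toInner_v (i : Fin 3) : K.toInner K.v i = .W i := by simp [toInner, K.u_ne_v.symm]

theorem toInner_inner (y : ({K.u, K.v}ᶜ : Set β)) (i : Fin 3) : K.toInner y i = .inner y := by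
  simp [toInner, K.inner_ne y]

variable {K}

theorem cases_base (x : α) : x = K.U ∨ x = K.V ∨ ∃ y : ({K.U, K.V}ᶜ : Set α), y.1 = x := by
  by_cases h : x = K.U
  · exact Or.inl h
  · by_cases h' : x = K.V
    · exact Or.inr (Or.inl h')
    · exact Or.inr (Or.inr ⟨⟨x, by simp [h, h']⟩, rfl⟩)

theorem cases_inner (x : β) : x = K.u ∨ x = K.v ∨ ∃ y : ({K.u, K.v}ᶜ : Set β), y.1 = x := by
  by_cases h : x = K.u
  · exact Or.inl h
  · by_cases h' : x = K.v
    · exact Or.inr (Or.inl h')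
    · exact Or.inr (Or.inr ⟨⟨x, by simp [h, h']⟩, rfl⟩)

section

variable {c : K.Vertex → K.Vertex → Klein} {p q : ({K.u, K.v}ᶜ : Set β)}

/-- If `b` is in `G'`, the sum has three equal terms and `k + k + k = k`; if `b` is on a strand,
only its own index contributes. -/
theorem Distinct.restrictBase_outer (hK : K.Distinct)
    (hc : IsPartialColoring K.graph s(.inner p, .inner q) c) (x : ({K.U, K.V}ᶜ : Set α))
    {b : K.Vertex} (hb : K.graph.Adj (.base x) b) :
    K.restrictBase c x (K.outer b) = c (.base x) b := by
  have hinj := (hK.bijOn_outer x).injOn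
  rcases b with y | y | i | i
  · simp only [restrictBase, outer, toBase_base, Fin.sum_univ_three, klein_add_add_self]
  · exact absurd hb K.not_adj_base_inner
  · simp only [restrictBase, outer, toBase_base, toBase_U]
    refine Finset.sum_eq_single i (fun j _ hj => ?_) (by simp)
    refine hc.eq_zero fun h => hj ?_
    simpa using hinj h hb rfl
  · simp only [restrictBase, outer, toBase_base, toBase_V]
    refine Finset.sum_eq_single i (fun j _ hj => ?_) (by simp)
    refine hc.eq_zero fun h => hj ?_
    simpa using hinj h hb rfl

theorem Distinct.restrictInner_inside (hK : K.Distinct)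
    (hc : IsPartialColoring K.graph s(.inner p, .inner q) c) (x : ({K.u, K.v}ᶜ : Set β))
    {b : K.Vertex} (hb : K.graph.Adj (.inner x) b) :
    K.restrictInner c x (K.inside b) = c (.inner x) b := by
  have hinj := (hK.bijOn_inside x).injOn
  rcases b with y | y | i | i
  · exact absurd hb K.not_adj_inner_base
  · simp only [restrictInner, inside, toInner_inner, Fin.sum_univ_three, klein_add_add_self]
  · simp only [restrictInner, inside, toInner_inner, toInner_u]
    refine Finset.sum_eq_single i (fun j _ hj => ?_) (by simp)
    refine hc.eq_zero fun h => hj ?_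
    simpa using hinj h hb rfl
  · simp only [restrictInner, inside, toInner_inner, toInner_v]
    refine Finset.sum_eq_single i (fun j _ hj => ?_) (by simp)
    refine hc.eq_zero fun h => hj ?_
    simpa using hinj h hb rfl

theorem restrictBase_symm (hc : IsPartialColoring K.graph s(.inner p, .inner q) c) (x y : α) :
    K.restrictBase c x y = K.restrictBase c y x :=
  Finset.sum_congr rfl fun _ _ => hc.symm _ _

theorem restrictInner_symm (hc : IsPartialColoring K.graph s(.inner p, .inner q) c) (x y : β) :
    K.restrictInner c x y = K.restrictInner c y x :=
  Finset.sum_congr rfl fun _ _ => hc.symm _ _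

theorem restrictBase_eq_zero (hc : IsPartialColoring K.graph s(.inner p, .inner q) c) {x y : α}
    (h : ¬ (G'.Adj x y ∧ s(x, y) ≠ s(K.U, K.V))) : K.restrictBase c x y = 0 := by
  refine Finset.sum_eq_zero fun i _ => hc.eq_zero fun hadj => h ?_
  have hU := K.adj_U_iff
  have hV := K.adj_V_iff
  have h1 := K.base_ne
  have hs := G'.adj_comm
  have hadj' := hadj
  revert hadj
  rcases cases_base (K := K) x with rfl | rfl | ⟨x, rfl⟩ <;>
    rcases cases_base (K := K) y with rfl | rfl | ⟨y, rfl⟩ <;>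
    simp only [toBase_U, toBase_V, toBase_base, adj_T_T, adj_W_W, not_adj_T_W, not_adj_W_T,
      adj_T_base, adj_base_T, adj_W_base, adj_base_W, adj_base_base, false_imp_iff, ne_eq,
      Sym2.eq_iff] <;>
    grind

theorem restrictInner_eq_zero (hc : IsPartialColoring K.graph s(.inner p, .inner q) c) {x y : β}
    (h : ¬ Gs.Adj x y) : K.restrictInner c x y = 0 := by
  refine Finset.sum_eq_zero fun i _ => hc.eq_zero fun hadj => h ?_
  have hU := K.adj_u_iff
  have hV := K.adj_v_iff
  have h1 := K.inner_ne
  have hs := Gs.adj_comm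
  revert hadj
  rcases cases_inner (K := K) x with rfl | rfl | ⟨x, rfl⟩ <;>
    rcases cases_inner (K := K) y with rfl | rfl | ⟨y, rfl⟩ <;>
    simp only [toInner_u, toInner_v, toInner_inner, adj_T_T, adj_W_W, not_adj_T_W, not_adj_W_T,
      adj_T_inner, adj_inner_T, adj_W_inner, adj_inner_W, adj_inner_inner, false_imp_iff] <;>
    grind

/-- Nothing is required at `U` and `V`, and elsewhere the star bijection `bijOn_outer` transports
the conditions. -/
theorem Distinct.isPartialColoring_restrictBase (hK : K.Distinct)
    (hc : IsPartialColoring K.graph s(.inner p, .inner q) c) :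
    IsPartialColoring G' s(K.U, K.V) (K.restrictBase c) := by
  have key (x : ({K.U, K.V}ᶜ : Set α)) (y : α) (h : G'.Adj x y) : K.restrictBase c x y ≠ 0 := by
    obtain ⟨b, hb, rfl⟩ := (hK.bijOn_outer x).surjOn h
    rw [hK.restrictBase_outer hc x hb, hc.ne_zero_iff]
    exact ⟨hb, by simp⟩
  refine ⟨restrictBase_symm hc, fun x y => ⟨fun h => by_contra fun h' => h (restrictBase_eq_zero hc h'),
    fun ⟨h, hne⟩ => ?_⟩, fun x hx y z hy hyz => ?_⟩
  · rcases cases_base (K := K) x with rfl | rfl | ⟨x, rfl⟩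
    · rcases cases_base (K := K) y with rfl | rfl | ⟨y, rfl⟩
      · exact absurd h G'.irrefl
      · exact absurd rfl hne
      · rw [restrictBase_symm hc]; exact key y _ h.symm
    · rcases cases_base (K := K) y with rfl | rfl | ⟨y, rfl⟩
      · exact absurd Sym2.eq_swap hne
      · exact absurd h G'.irrefl
      · rw [restrictBase_symm hc]; exact key y _ h.symm
    · exact key x y h
  · rw [Sym2.mem_iff, not_or] at hx
    obtain ⟨x, rfl⟩ := ((cases_base (K := K) x).resolve_left hx.1).resolve_left hx.2
    have hz : K.restrictBase c x z ≠ 0 := hyz ▸ hy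
    have ay : G'.Adj x y := by_contra fun h => hy (restrictBase_eq_zero hc fun h' => h h'.1)
    have az : G'.Adj x z := by_contra fun h => hz (restrictBase_eq_zero hc fun h' => h h'.1)
    obtain ⟨b, hb, rfl⟩ := (hK.bijOn_outer x).surjOn ay
    obtain ⟨b', hb', rfl⟩ := (hK.bijOn_outer x).surjOn az
    rw [hK.restrictBase_outer hc x hb] at hy hyz
    rw [hK.restrictBase_outer hc x hb'] at hyz
    rw [hc.proper _ (by simp) _ _ hy hyz]

/-- The colors at a strand: `k`, `l`, `m` are those along it and `d₀`, `d₁`, `d₂` the others. -/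
theorem strand_colors {k l m d₀ d₁ d₂ : Klein} (hk : k ≠ 0) (hl : l ≠ 0) (hm : m ≠ 0)
    (h₀ : d₀ ≠ 0) (h₁ : d₁ ≠ 0) (h₂ : d₂ ≠ 0) (hkl : k ≠ l) (hlm : l ≠ m) (hkm : k ≠ m)
    (hk0 : k ≠ d₀) (hl0 : l ≠ d₀) (hl1 : l ≠ d₁) (hm1 : m ≠ d₁) (hk2 : k ≠ d₂) (hm2 : m ≠ d₂) :
    d₀ = m ∧ d₁ = k ∧ d₂ = l := by
  have h := klein_sum_eq_zero k l m hk hl hm hkl hkm hlm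
  have e0 := klein_sum_eq_zero k l d₀ hk hl h₀ hkl hk0 hl0
  have e1 := klein_sum_eq_zero l m d₁ hl hm h₁ hlm hl1 hm1
  have e2 := klein_sum_eq_zero k m d₂ hk hm h₂ hkm hk2 hm2
  refine ⟨add_left_cancel (e0.trans h.symm), add_left_cancel (a := l + m) ?_,
    add_left_cancel (a := k + m) ?_⟩
  · rw [e1, ← h]; abel
  · rw [e2, ← h]; abel

end

end SuperpositionData
-- Colors at the strands
namespace SuperpositionData

variable {α β : Type*} {G' : SimpleGraph α} {Gs : SimpleGraph β} {K : SuperpositionData G' Gs}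
  {c : K.Vertex → K.Vertex → Klein} {p q : ({K.u, K.v}ᶜ : Set β)}

/-- Since both outer edges of the strand have the same color, this color and the two along the
strand are all different, and `strand_colors` determines the three edges to `G*`. Injectivity is
properness at `u`; the equations allow the coloring to be recovered from its restrictions. -/
theorem Distinct.strand_T (hK : K.Distinct)
    (hc : IsSplitColoring K.graph s(.inner p, .inner q) c)
    (hc' : IsSplitColoring G' s(K.U, K.V) (K.restrictBase c)) :
    K.restrictInner c K.u (K.us 0) = c (.T 1) (.T 2) ∧
      K.restrictInner c K.u (K.us 1) = K.restrictBase c K.U K.Tneg ∧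
      K.restrictInner c K.u (K.us 2) = c (.T 0) (.T 1) ∧
      Function.Injective fun i => K.restrictInner c K.u (K.us i) := by
  have hp := hc.toIsPartialColoring
  let t : ({K.U, K.V}ᶜ : Set α) := ⟨K.Tneg, by simp [hK.Tneg_ne_U, hK.Tneg_ne_V]⟩
  let t' : ({K.U, K.V}ᶜ : Set α) := ⟨K.Tpos, by simp [hK.Tpos_ne_U, hK.Tpos_ne_V]⟩
  let y (i : Fin 3) : ({K.u, K.v}ᶜ : Set β) := ⟨K.us i, by simp [hK.us_ne_u, hK.us_ne_v]⟩
  have at0 : K.graph.Adj (.T 0) (.base t) := K.adj_T_base.2 (by simp [t])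
  have at2 : K.graph.Adj (.T 2) (.base t') := K.adj_T_base.2 (by simp [t'])
  have a01 : K.graph.Adj (.T 0) (.T 1) := K.adj_T_T.2 (by simp)
  have a12 : K.graph.Adj (.T 1) (.T 2) := K.adj_T_T.2 (by simp)
  have ay (i) : K.graph.Adj (.T i) (.inner (y i)) := K.adj_T_inner.2 rfl
  have e0 : K.restrictBase c K.U K.Tneg = c (.T 0) (.base t) := by
    rw [restrictBase_symm hp, hp.symm]
    exact hK.restrictBase_outer hp t at0.symm
  have e2 : K.restrictBase c K.U K.Tpos = c (.T 2) (.base t') := by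
    rw [restrictBase_symm hp, hp.symm]
    exact hK.restrictBase_outer hp t' at2.symm
  have ey (i) : K.restrictInner c K.u (K.us i) = c (.T i) (.inner (y i)) := by
    rw [restrictInner_symm hp, hp.symm]
    exact hK.restrictInner_inside hp (y i) (ay i).symm
  have hne {i : Fin 3} {b : K.Vertex} (h : K.graph.Adj (.T i) b) : c (.T i) b ≠ 0 :=
    (hp.ne_zero_iff _ _).2 ⟨h, by simp⟩
  have hprop {i : Fin 3} {b b' : K.Vertex} (h : K.graph.Adj (.T i) b) (hbb : b ≠ b') :
      c (.T i) b ≠ c (.T i) b' := fun h' => hbb (hp.proper _ (by simp) _ _ (hne h) h')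
  have s01 := hp.symm (.T 0) (.T 1)
  have s12 := hp.symm (.T 1) (.T 2)
  -- The splitness of the restriction to `G'` enters here; it yields `hkm`.
  have hend : c (.T 2) (.base t') = c (.T 0) (.base t) := by
    rw [← e0, ← e2]
    refine hc'.ends _ (by simp) _ _ ?_ ?_
    · rw [e2]; exact hne at2
    · rw [e0]; exact hne at0
  have hkl : c (.T 0) (.base t) ≠ c (.T 0) (.T 1) := hprop at0 (by simp)
  have hlm : c (.T 0) (.T 1) ≠ c (.T 1) (.T 2) := by rw [s01]; exact hprop a01.symm (by simp)
  have hkm : c (.T 0) (.base t) ≠ c (.T 1) (.T 2) := by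
    rw [s12, ← hend]; exact hprop at2 (by simp)
  obtain ⟨h0, h1, h2⟩ := strand_colors (hne at0) (hne a01) (hne a12) (hne (ay 0)) (hne (ay 1))
    (hne (ay 2)) hkl hlm hkm (hprop at0 (by simp)) (hprop a01 (by simp))
    (by rw [s01]; exact hprop a01.symm (by simp)) (hprop a12 (by simp))
    (by rw [← hend]; exact hprop at2 (by simp)) (by rw [s12]; exact hprop a12.symm (by simp))
  refine ⟨(ey 0).trans h0, (ey 1).trans (h1.trans e0.symm), (ey 2).trans h2, fun i j hij => ?_⟩
  simp only [ey] at hij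
  have hi : i = 0 ∨ i = 1 ∨ i = 2 := by omega
  have hj : j = 0 ∨ j = 1 ∨ j = 2 := by omega
  rcases hi with rfl | rfl | rfl <;> rcases hj with rfl | rfl | rfl <;> grind

theorem Distinct.strand_W (hK : K.Distinct)
    (hc : IsSplitColoring K.graph s(.inner p, .inner q) c)
    (hc' : IsSplitColoring G' s(K.U, K.V) (K.restrictBase c)) :
    K.restrictInner c K.v (K.vs 0) = c (.W 1) (.W 2) ∧
      K.restrictInner c K.v (K.vs 1) = K.restrictBase c K.V K.Wneg ∧
      K.restrictInner c K.v (K.vs 2) = c (.W 0) (.W 1) ∧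
      Function.Injective fun i => K.restrictInner c K.v (K.vs i) := by
  have hp := hc.toIsPartialColoring
  let t : ({K.U, K.V}ᶜ : Set α) := ⟨K.Wneg, by simp [hK.Wneg_ne_U, hK.Wneg_ne_V]⟩
  let t' : ({K.U, K.V}ᶜ : Set α) := ⟨K.Wpos, by simp [hK.Wpos_ne_U, hK.Wpos_ne_V]⟩
  let y (i : Fin 3) : ({K.u, K.v}ᶜ : Set β) := ⟨K.vs i, by simp [hK.vs_ne_u, hK.vs_ne_v]⟩
  have at0 : K.graph.Adj (.W 0) (.base t) := K.adj_W_base.2 (by simp [t])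
  have at2 : K.graph.Adj (.W 2) (.base t') := K.adj_W_base.2 (by simp [t'])
  have a01 : K.graph.Adj (.W 0) (.W 1) := K.adj_W_W.2 (by simp)
  have a12 : K.graph.Adj (.W 1) (.W 2) := K.adj_W_W.2 (by simp)
  have ay (i) : K.graph.Adj (.W i) (.inner (y i)) := K.adj_W_inner.2 rfl
  have e0 : K.restrictBase c K.V K.Wneg = c (.W 0) (.base t) := by
    rw [restrictBase_symm hp, hp.symm]
    exact hK.restrictBase_outer hp t at0.symm
  have e2 : K.restrictBase c K.V K.Wpos = c (.W 2) (.base t') := by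
    rw [restrictBase_symm hp, hp.symm]
    exact hK.restrictBase_outer hp t' at2.symm
  have ey (i) : K.restrictInner c K.v (K.vs i) = c (.W i) (.inner (y i)) := by
    rw [restrictInner_symm hp, hp.symm]
    exact hK.restrictInner_inside hp (y i) (ay i).symm
  have hne {i : Fin 3} {b : K.Vertex} (h : K.graph.Adj (.W i) b) : c (.W i) b ≠ 0 :=
    (hp.ne_zero_iff _ _).2 ⟨h, by simp⟩
  have hprop {i : Fin 3} {b b' : K.Vertex} (h : K.graph.Adj (.W i) b) (hbb : b ≠ b') :
      c (.W i) b ≠ c (.W i) b' := fun h' => hbb (hp.proper _ (by simp) _ _ (hne h) h')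
  have s01 := hp.symm (.W 0) (.W 1)
  have s12 := hp.symm (.W 1) (.W 2)
  have hend : c (.W 2) (.base t') = c (.W 0) (.base t) := by
    rw [← e0, ← e2]
    refine hc'.ends _ (by simp) _ _ ?_ ?_
    · rw [e2]; exact hne at2
    · rw [e0]; exact hne at0
  have hkl : c (.W 0) (.base t) ≠ c (.W 0) (.W 1) := hprop at0 (by simp)
  have hlm : c (.W 0) (.W 1) ≠ c (.W 1) (.W 2) := by rw [s01]; exact hprop a01.symm (by simp)
  have hkm : c (.W 0) (.base t) ≠ c (.W 1) (.W 2) := by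
    rw [s12, ← hend]; exact hprop at2 (by simp)
  obtain ⟨h0, h1, h2⟩ := strand_colors (hne at0) (hne a01) (hne a12) (hne (ay 0)) (hne (ay 1))
    (hne (ay 2)) hkl hlm hkm (hprop at0 (by simp)) (hprop a01 (by simp))
    (by rw [s01]; exact hprop a01.symm (by simp)) (hprop a12 (by simp))
    (by rw [← hend]; exact hprop at2 (by simp)) (by rw [s12]; exact hprop a12.symm (by simp))
  refine ⟨(ey 0).trans h0, (ey 1).trans (h1.trans e0.symm), (ey 2).trans h2, fun i j hij => ?_⟩
  simp only [ey] at hij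
  have hi : i = 0 ∨ i = 1 ∨ i = 2 := by omega
  have hj : j = 0 ∨ j = 1 ∨ j = 2 := by omega
  rcases hi with rfl | rfl | rfl <;> rcases hj with rfl | rfl | rfl <;> grind

/-- Properness at `u` and `v` comes from the strands; all other vertices have the same star in both
graphs. -/
theorem Distinct.isSplitColoring_restrictInner (hK : K.Distinct)
    (hc : IsSplitColoring K.graph s(.inner p, .inner q) c)
    (hc' : IsSplitColoring G' s(K.U, K.V) (K.restrictBase c)) :
    IsSplitColoring Gs s(p.1, q.1) (K.restrictInner c) := by
  have hp := hc.toIsPartialColoring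
  have hz : K.restrictInner c p.1 q.1 = 0 := by
    have : c (.inner p) (.inner q) = 0 := by
      by_contra h
      exact ((hp.ne_zero_iff _ _).1 h).2 rfl
    simp [restrictInner, toInner_inner, this]
  have adj {x y : β} (h : K.restrictInner c x y ≠ 0) : Gs.Adj x y :=
    by_contra fun h' => h (restrictInner_eq_zero hp h')
  have key (x : ({K.u, K.v}ᶜ : Set β)) (y : β) (h : Gs.Adj x y) (hne : s(x.1, y) ≠ s(p.1, q.1)) :
      K.restrictInner c x y ≠ 0 := by
    obtain ⟨b, hb, rfl⟩ := (hK.bijOn_inside x).surjOn h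
    rw [hK.restrictInner_inside hp x hb, hp.ne_zero_iff]
    refine ⟨hb, fun he => hne ?_⟩
    have := congrArg (Sym2.map K.inside) he
    simpa only [Sym2.map_mk, inside] using this
  have star {x y z : β} (hx : x ≠ K.u) (hx' : x ≠ K.v) (hy : K.restrictInner c x y ≠ 0)
      (hz : K.restrictInner c x z ≠ 0) : ∃ (x' : _) (b b' : K.Vertex), x = x'.1 ∧ y = K.inside b ∧
        z = K.inside b' ∧ K.restrictInner c x y = c (.inner x') b ∧
        K.restrictInner c x z = c (.inner x') b' := by
    obtain ⟨x, rfl⟩ := ((cases_inner (K := K) x).resolve_left hx).resolve_left hx'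
    obtain ⟨b, hb, rfl⟩ := (hK.bijOn_inside x).surjOn (adj hy)
    obtain ⟨b', hb', rfl⟩ := (hK.bijOn_inside x).surjOn (adj hz)
    exact ⟨x, b, b', rfl, rfl, rfl, hK.restrictInner_inside hp x hb,
      hK.restrictInner_inside hp x hb'⟩
  have hinner (x : ({K.u, K.v}ᶜ : Set β)) : (Vertex.inner x : K.Vertex) ∈
      s((Vertex.inner p : K.Vertex), Vertex.inner q) ↔ x.1 ∈ s(p.1, q.1) := by
    simp [Subtype.ext_iff]
  refine ⟨⟨restrictInner_symm hp, fun x y => ⟨fun h => ⟨adj h, fun he => h ?_⟩, fun ⟨h, hne⟩ => ?_⟩,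
    fun x hx y z hy hyz => ?_⟩, fun x hx y z hy hyz => ?_⟩
  · rcases Sym2.eq_iff.1 he with ⟨rfl, rfl⟩ | ⟨rfl, rfl⟩
    · exact hz
    · rw [restrictInner_symm hp, hz]
  · rcases cases_inner (K := K) x with rfl | rfl | ⟨x, rfl⟩
    · rcases cases_inner (K := K) y with rfl | rfl | ⟨y, rfl⟩
      · exact absurd h Gs.irrefl
      · exact absurd h K.not_adj_uv
      · rw [restrictInner_symm hp]; exact key y _ h.symm (by rwa [Sym2.eq_swap])
    · rcases cases_inner (K := K) y with rfl | rfl | ⟨y, rfl⟩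
      · exact absurd h.symm K.not_adj_uv
      · exact absurd h Gs.irrefl
      · rw [restrictInner_symm hp]; exact key y _ h.symm (by rwa [Sym2.eq_swap])
    · exact key x y h hne
  · have hz' := hyz ▸ hy
    by_cases hu : x = K.u
    · subst hu
      obtain ⟨i, rfl⟩ := (K.adj_u_iff y).1 (adj hy)
      obtain ⟨j, rfl⟩ := (K.adj_u_iff z).1 (adj hz')
      exact congrArg K.us ((hK.strand_T hc hc').2.2.2 hyz)
    by_cases hv : x = K.v
    · subst hv
      obtain ⟨i, rfl⟩ := (K.adj_v_iff y).1 (adj hy)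
      obtain ⟨j, rfl⟩ := (K.adj_v_iff z).1 (adj hz')
      exact congrArg K.vs ((hK.strand_W hc hc').2.2.2 hyz)
    obtain ⟨x', b, b', rfl, rfl, rfl, h1, h2⟩ := star hu hv hy hz'
    rw [h1] at hy hyz
    rw [h2] at hyz
    rw [hp.proper _ ((hinner x').not.2 hx) _ _ hy hyz]
  · have hxp : x ≠ K.u ∧ x ≠ K.v := by
      rcases Sym2.mem_iff.1 hx with rfl | rfl
      exacts [K.inner_ne p, K.inner_ne q]
    obtain ⟨x', b, b', rfl, rfl, rfl, h1, h2⟩ := star hxp.1 hxp.2 hy hyz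
    rw [h1] at hy ⊢
    rw [h2] at hyz ⊢
    exact hc.ends _ ((hinner x').2 hx) _ _ hy hyz

end SuperpositionData
-- Gluing split colorings
namespace SuperpositionData

variable {α β : Type*} {G' : SimpleGraph α} {Gs : SimpleGraph β} {K : SuperpositionData G' Gs}
  {c : α → α → Klein} {d : β → β → Klein} {p q : ({K.u, K.v}ᶜ : Set β)}

theorem finite_vertex [Finite α] [Finite β] (K : SuperpositionData G' Gs) : Finite K.Vertex := by
  refine Finite.of_surjective (α := (({K.U, K.V}ᶜ : Set α) ⊕ ({K.u, K.v}ᶜ : Set β)) ⊕ Fin 3 ⊕ Fin 3)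
    (Sum.elim (Sum.elim .base .inner) (Sum.elim .T .W)) ?_
  rintro (x | x | i | i)
  · exact ⟨.inl (.inl x), rfl⟩
  · exact ⟨.inl (.inr x), rfl⟩
  · exact ⟨.inr (.inl i), rfl⟩
  · exact ⟨.inr (.inr i), rfl⟩

theorem glue_of_adj {a b : K.Vertex} (h : K.graph.Adj a b) : K.glue c d a b = K.glueAux c d a b :=
  if_pos h

theorem glue_of_not_adj {a b : K.Vertex} (h : ¬ K.graph.Adj a b) : K.glue c d a b = 0 :=
  if_neg h

theorem adj_of_glue_ne_zero {a b : K.Vertex} (h : K.glue c d a b ≠ 0) : K.graph.Adj a b :=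
  by_contra fun h' => h (glue_of_not_adj h')

theorem glue_symm (hc : ∀ x y, c x y = c y x) (hd : ∀ x y, d x y = d y x) (a b : K.Vertex) :
    K.glue c d a b = K.glue c d b a := by
  by_cases h : K.graph.Adj a b
  · rw [glue_of_adj h, glue_of_adj h.symm]
    revert h
    rcases a with x | x | i | i <;> rcases b with y | y | j | j <;>
      simp only [glueAux, outer, inside, not_adj_base_inner, not_adj_inner_base, not_adj_T_W,
        not_adj_W_T, false_imp_iff] <;>
      first
        | exact fun _ => hc _ _
        | exact fun _ => hd _ _
        | exact fun _ => by rw [add_comm]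
  · rw [glue_of_not_adj h, glue_of_not_adj fun h' => h h'.symm]

/-- The index of the neighbor of `u` whose color is used at a neighbor of a strand vertex. -/
def strandIndex (K : SuperpositionData G' Gs) (i : Fin 3) : K.Vertex → Fin 3
  | .base _ => 1
  | .inner _ => i
  | .T j => -(i + j)
  | .W j => -(i + j)

/-- The three neighbors of `T i` receive three different indices: `i` towards `G*`, and the
remaining two for the others. A glued coloring is thus as proper at `T i` as `d` is at `u`. -/
theorem strandIndex_injOn_T (i : Fin 3) :
    Set.InjOn (K.strandIndex i) (K.graph.neighborSet (.T i)) := by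
  have hi : i = 0 ∨ i = 1 ∨ i = 2 := by omega
  rintro (x | x | j | j) h (y | y | k | k) h' he <;>
    simp only [SimpleGraph.mem_neighborSet, adj_T_base, adj_T_inner, adj_T_T,
      not_adj_T_W] at h h' <;>
    simp only [strandIndex] at he <;>
    simp only [Vertex.base.injEq, Vertex.inner.injEq, Vertex.T.injEq, Subtype.ext_iff,
      reduceCtorEq] <;>
    rcases hi with rfl | rfl | rfl <;> grind

theorem strandIndex_injOn_W (i : Fin 3) :
    Set.InjOn (K.strandIndex i) (K.graph.neighborSet (.W i)) := by
  have hi : i = 0 ∨ i = 1 ∨ i = 2 := by omega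
  rintro (x | x | j | j) h (y | y | k | k) h' he <;>
    simp only [SimpleGraph.mem_neighborSet, adj_W_base, adj_W_inner, adj_W_W,
      not_adj_W_T] at h h' <;>
    simp only [strandIndex] at he <;>
    simp only [Vertex.base.injEq, Vertex.inner.injEq, Vertex.W.injEq, Subtype.ext_iff,
      reduceCtorEq] <;>
    rcases hi with rfl | rfl | rfl <;> grind

theorem Distinct.glue_T (hK : K.Distinct) (hc : IsSplitColoring G' s(K.U, K.V) c)
    (h : c K.U K.Tneg = d K.u (K.us 1)) {i : Fin 3} {b : K.Vertex} (hb : K.graph.Adj (.T i) b) :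
    K.glue c d (.T i) b = d K.u (K.us (K.strandIndex i b)) := by
  -- Splitness makes the two outer edges of the strand agree, so index 1 serves both.
  have hpos : c K.U K.Tpos = c K.U K.Tneg := hc.ends _ (by simp) _ _
    (hc.end_ne_zero hK.Tpos_ne_V ((K.adj_U_iff _).2 (by simp)))
    (hc.end_ne_zero hK.Tneg_ne_V ((K.adj_U_iff _).2 (by simp)))
  rw [glue_of_adj hb]
  rcases b with x | x | j | j
  · rw [adj_T_base] at hb
    simp only [glueAux, strandIndex, ← h]
    grind
  · rw [adj_T_inner] at hb
    simp only [glueAux, strandIndex, hb]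
  · rfl
  · exact absurd hb K.not_adj_T_W

theorem Distinct.glue_W (hK : K.Distinct) (hc : IsSplitColoring G' s(K.U, K.V) c)
    (h : c K.V K.Wneg = d K.v (K.vs 1)) {i : Fin 3} {b : K.Vertex} (hb : K.graph.Adj (.W i) b) :
    K.glue c d (.W i) b = d K.v (K.vs (K.strandIndex i b)) := by
  have hpos : c K.V K.Wpos = c K.V K.Wneg := hc.ends _ (by simp) _ _
    (hc.end_ne_zero' hK.Wpos_ne_U ((K.adj_V_iff _).2 (by simp)))
    (hc.end_ne_zero' hK.Wneg_ne_U ((K.adj_V_iff _).2 (by simp)))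
  rw [glue_of_adj hb]
  rcases b with x | x | j | j
  · rw [adj_W_base] at hb
    simp only [glueAux, strandIndex, ← h]
    grind
  · rw [adj_W_inner] at hb
    simp only [glueAux, strandIndex, hb]
  · exact absurd hb K.not_adj_W_T
  · rfl

theorem Distinct.isSplitColoring_glue (hK : K.Distinct) (hc : IsSplitColoring G' s(K.U, K.V) c)
    (hd : IsSplitColoring Gs s(p.1, q.1) d) (hT : c K.U K.Tneg = d K.u (K.us 1))
    (hW : c K.V K.Wneg = d K.v (K.vs 1)) :
    IsSplitColoring K.graph s(.inner p, .inner q) (K.glue c d) := by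
  have hu : K.u ∉ s(p.1, q.1) := by
    have := K.inner_ne p
    have := K.inner_ne q
    rw [Sym2.mem_iff]; grind
  have hv : K.v ∉ s(p.1, q.1) := by
    have := K.inner_ne p
    have := K.inner_ne q
    rw [Sym2.mem_iff]; grind
  have hinner (x : ({K.u, K.v}ᶜ : Set β)) : (Vertex.inner x : K.Vertex) ∈
      s((Vertex.inner p : K.Vertex), Vertex.inner q) ↔ x.1 ∈ s(p.1, q.1) := by
    simp [Subtype.ext_iff]
  have hdu (i) : d K.u (K.us i) ≠ 0 := by
    rw [hd.ne_zero_iff, adj_u_iff]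
    exact ⟨⟨i, rfl⟩, fun h => hu (h ▸ Sym2.mem_mk_left _ _)⟩
  have hdv (i) : d K.v (K.vs i) ≠ 0 := by
    rw [hd.ne_zero_iff, adj_v_iff]
    exact ⟨⟨i, rfl⟩, fun h => hv (h ▸ Sym2.mem_mk_left _ _)⟩
  have hcx (x : ({K.U, K.V}ᶜ : Set α)) : x.1 ∉ s(K.U, K.V) := by
    have := K.base_ne x
    rw [Sym2.mem_iff]; grind
  refine ⟨⟨glue_symm hc.symm hd.symm, fun a b => ?_, fun a ha b b' hb hbb => ?_⟩,
    fun a ha b b' hb hb' => ?_⟩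
  · by_cases h : K.graph.Adj a b
    swap
    · exact iff_of_false (fun h' => h (adj_of_glue_ne_zero h')) fun h' => h h'.1
    simp only [h, true_and]
    rcases a with x | x | i | i
    · refine iff_of_true ?_ (by simp)
      rw [glue_of_adj h]
      refine (hc.ne_zero_iff _ _).2 ⟨(hK.bijOn_outer x).mapsTo h, fun h' => hcx x ?_⟩
      exact h' ▸ Sym2.mem_mk_left _ _
    · rw [glue_of_adj h]
      refine (hd.ne_zero_iff _ _).trans ?_
      have hadj : Gs.Adj x (K.inside b) := (hK.bijOn_inside x).mapsTo h
      rw [and_iff_right hadj, not_iff_not]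
      have hi := K.inner_ne
      rcases b with y | y | j | j
      · exact absurd h K.not_adj_inner_base
      all_goals
        simp only [inside, Sym2.eq_iff, Vertex.inner.injEq, Subtype.ext_iff, reduceCtorEq] <;>
          grind
    · refine iff_of_true ?_ (by simp)
      rw [hK.glue_T hc hT h]
      exact hdu _
    · refine iff_of_true ?_ (by simp)
      rw [hK.glue_W hc hW h]
      exact hdv _
  · have hab := adj_of_glue_ne_zero hb
    have hab' := adj_of_glue_ne_zero (hbb ▸ hb)
    rcases a with x | x | i | i
    · rw [glue_of_adj hab] at hb hbb
      rw [glue_of_adj hab'] at hbb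
      exact (hK.bijOn_outer x).injOn hab hab' (hc.proper _ (hcx x) _ _ hb hbb)
    · rw [glue_of_adj hab] at hb hbb
      rw [glue_of_adj hab'] at hbb
      exact (hK.bijOn_inside x).injOn hab hab' (hd.proper _ ((hinner x).not.1 ha) _ _ hb hbb)
    · rw [hK.glue_T hc hT hab] at hb hbb
      rw [hK.glue_T hc hT hab'] at hbb
      exact strandIndex_injOn_T i hab hab' (hK.us_injective (hd.proper _ hu _ _ hb hbb))
    · rw [hK.glue_W hc hW hab] at hb hbb
      rw [hK.glue_W hc hW hab'] at hbb
      exact strandIndex_injOn_W i hab hab' (hK.vs_injective (hd.proper _ hv _ _ hb hbb))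
  · obtain ⟨x, rfl⟩ : ∃ x, a = .inner x := by
      rcases Sym2.mem_iff.1 ha with rfl | rfl
      exacts [⟨p, rfl⟩, ⟨q, rfl⟩]
    have hab := adj_of_glue_ne_zero hb
    have hab' := adj_of_glue_ne_zero hb'
    rw [glue_of_adj hab] at hb ⊢
    rw [glue_of_adj hab'] at hb' ⊢
    exact hd.ends _ ((hinner x).1 ha) _ _ hb hb'

theorem Distinct.restrictBase_glue (hK : K.Distinct) (hc : IsSplitColoring G' s(K.U, K.V) c)
    (hg : IsSplitColoring K.graph s(.inner p, .inner q) (K.glue c d)) :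
    K.restrictBase (K.glue c d) = c := by
  have hp := hg.toIsPartialColoring
  have hr := hK.isPartialColoring_restrictBase hp
  have key (x : ({K.U, K.V}ᶜ : Set α)) (y : α) (h : G'.Adj x y) :
      K.restrictBase (K.glue c d) x y = c x y := by
    obtain ⟨b, hb, rfl⟩ := (hK.bijOn_outer x).surjOn h
    rw [hK.restrictBase_outer hp x hb, glue_of_adj hb]
    rfl
  funext x y
  by_cases h : G'.Adj x y ∧ s(x, y) ≠ s(K.U, K.V)
  · rcases cases_base (K := K) x with rfl | rfl | ⟨x, rfl⟩
    · rcases cases_base (K := K) y with rfl | rfl | ⟨y, rfl⟩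
      · exact absurd h.1 G'.irrefl
      · exact absurd rfl h.2
      · rw [restrictBase_symm hp, hc.symm]; exact key y _ h.1.symm
    · rcases cases_base (K := K) y with rfl | rfl | ⟨y, rfl⟩
      · exact absurd Sym2.eq_swap h.2
      · exact absurd h.1 G'.irrefl
      · rw [restrictBase_symm hp, hc.symm]; exact key y _ h.1.symm
    · exact key x y h.1
  · rw [restrictBase_eq_zero hp h]
    exact (not_not.1 ((hc.ne_zero_iff x y).not.2 h)).symm

theorem Distinct.restrictInner_glue (hK : K.Distinct) (hd : IsSplitColoring Gs s(p.1, q.1) d)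
    (hg : IsSplitColoring K.graph s(.inner p, .inner q) (K.glue c d)) :
    K.restrictInner (K.glue c d) = d := by
  have hp := hg.toIsPartialColoring
  have key (x : ({K.u, K.v}ᶜ : Set β)) (y : β) (h : Gs.Adj x y) :
      K.restrictInner (K.glue c d) x y = d x y := by
    obtain ⟨b, hb, rfl⟩ := (hK.bijOn_inside x).surjOn h
    rw [hK.restrictInner_inside hp x hb, glue_of_adj hb]
    rfl
  funext x y
  by_cases h : Gs.Adj x y
  · rcases cases_inner (K := K) x with rfl | rfl | ⟨x, rfl⟩
    · rcases cases_inner (K := K) y with rfl | rfl | ⟨y, rfl⟩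
      · exact absurd h Gs.irrefl
      · exact absurd h K.not_adj_uv
      · rw [restrictInner_symm hp, hd.symm]; exact key y _ h.symm
    · rcases cases_inner (K := K) y with rfl | rfl | ⟨y, rfl⟩
      · exact absurd h.symm K.not_adj_uv
      · exact absurd h Gs.irrefl
      · rw [restrictInner_symm hp, hd.symm]; exact key y _ h.symm
    · exact key x y h
  · rw [restrictInner_eq_zero hp h, hd.eq_zero h]

/-- Edges with an end in `G'` or `G*` are read off directly; the edges along a strand are recovered
from the colors at indices 0 and 2. -/
theorem Distinct.glue_restrict (hK : K.Distinct) {c : K.Vertex → K.Vertex → Klein}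
    (hc : IsSplitColoring K.graph s(.inner p, .inner q) c)
    (hc' : IsSplitColoring G' s(K.U, K.V) (K.restrictBase c)) :
    K.glue (K.restrictBase c) (K.restrictInner c) = c := by
  have hp := hc.toIsPartialColoring
  have hs := glue_symm (K := K) (restrictBase_symm hp) (restrictInner_symm hp)
  have hbase (x : ({K.U, K.V}ᶜ : Set α)) (b : K.Vertex) (h : K.graph.Adj (.base x) b) :
      K.glue (K.restrictBase c) (K.restrictInner c) (.base x) b = c (.base x) b := by
    rw [← hK.restrictBase_outer hp x h, glue_of_adj h]
    rfl
  have hinner (x : ({K.u, K.v}ᶜ : Set β)) (b : K.Vertex) (h : K.graph.Adj (.inner x) b) :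
      K.glue (K.restrictBase c) (K.restrictInner c) (.inner x) b = c (.inner x) b := by
    rw [← hK.restrictInner_inside hp x h, glue_of_adj h]
    rfl
  obtain ⟨t0, -, t2, -⟩ := hK.strand_T hc hc'
  obtain ⟨w0, -, w2, -⟩ := hK.strand_W hc hc'
  funext a b
  by_cases h : K.graph.Adj a b
  swap
  · rw [glue_of_not_adj h, hp.eq_zero h]
  rcases a with x | x | i | i
  · exact hbase x b h
  · exact hinner x b h
  · rcases b with y | y | j | j
    · rw [hs, hp.symm]; exact hbase y _ h.symm
    · rw [hs, hp.symm]; exact hinner y _ h.symm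
    · rw [glue_of_adj h]
      rw [adj_T_T] at h
      have hij : (i = 0 ∧ j = 1) ∨ (i = 1 ∧ j = 0) ∨ (i = 1 ∧ j = 2) ∨ (i = 2 ∧ j = 1) := by omega
      rcases hij with ⟨rfl, rfl⟩ | ⟨rfl, rfl⟩ | ⟨rfl, rfl⟩ | ⟨rfl, rfl⟩
      · exact t2
      · rw [hp.symm]; exact t2
      · exact t0
      · rw [hp.symm]; exact t0
    · exact absurd h K.not_adj_T_W
  · rcases b with y | y | j | j
    · rw [hs, hp.symm]; exact hbase y _ h.symm
    · rw [hs, hp.symm]; exact hinner y _ h.symm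
    · exact absurd h K.not_adj_W_T
    · rw [glue_of_adj h]
      rw [adj_W_W] at h
      have hij : (i = 0 ∧ j = 1) ∨ (i = 1 ∧ j = 0) ∨ (i = 1 ∧ j = 2) ∨ (i = 2 ∧ j = 1) := by omega
      rcases hij with ⟨rfl, rfl⟩ | ⟨rfl, rfl⟩ | ⟨rfl, rfl⟩ | ⟨rfl, rfl⟩
      · exact w2
      · rw [hp.symm]; exact w2
      · exact w0
      · rw [hp.symm]; exact w0

/-! ### Counting -/

/-- The split colorings of the superposition are the pairs of split colorings of the two graphs
that agree at the strands. -/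
noncomputable def Distinct.splitColoringEquiv [Finite α] (hK : K.Distinct) (hG' : IsCubic G')
    (hcol : ¬ G'.lineGraph.Colorable 3) (p q : ({K.u, K.v}ᶜ : Set β)) :
    {c // IsSplitColoring K.graph s(.inner p, .inner q) c} ≃
      Σ d : {d // IsSplitColoring Gs s(p.1, q.1) d},
        {c // IsSplitColoring G' s(K.U, K.V) c ∧ c K.U K.Tneg = d.1 K.u (K.us 1) ∧
          c K.V K.Wneg = d.1 K.v (K.vs 1)} where
  toFun c :=
    have hc' := (hK.isPartialColoring_restrictBase c.2.toIsPartialColoring).isSplitColoring hG'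
      hcol K.adj_UV
    ⟨⟨K.restrictInner c.1, hK.isSplitColoring_restrictInner c.2 hc'⟩,
      ⟨K.restrictBase c.1, hc', (hK.strand_T c.2 hc').2.1.symm, (hK.strand_W c.2 hc').2.1.symm⟩⟩
  invFun z := ⟨K.glue z.2.1 z.1.1, hK.isSplitColoring_glue z.2.2.1 z.1.2 z.2.2.2.1 z.2.2.2.2⟩
  left_inv c := by
    have hc' := (hK.isPartialColoring_restrictBase c.2.toIsPartialColoring).isSplitColoring hG'
      hcol K.adj_UV
    exact Subtype.ext (hK.glue_restrict c.2 hc')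
  right_inv := by
    rintro ⟨⟨d, hd⟩, ⟨c, hc, hT, hW⟩⟩
    have hg := hK.isSplitColoring_glue hc hd hT hW
    have h1 := hK.restrictInner_glue hd hg
    have h2 := hK.restrictBase_glue hc hg
    -- The type of the second component depends on the first, so its equality is heterogeneous until
    -- `h1` is used.
    refine Sigma.ext (Subtype.ext h1) ?_
    simp only
    congr! 1
    ext; rw [h1]

/-- Each `d` prescribes one nonzero color at `U` and one at `V`; by equidistribution the number of
matching `c` does not depend on `d`. -/
theorem Distinct.nine_mul_card [Finite α] [Finite β] (hK : K.Distinct) (hG' : IsCubic G')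
    (hg' : 5 ≤ G'.egirth) (hcol : ¬ G'.lineGraph.Colorable 3) (p q : ({K.u, K.v}ᶜ : Set β)) :
    9 * Nat.card {c // IsSplitColoring K.graph s(.inner p, .inner q) c} =
      Nat.card {d // IsSplitColoring Gs s(p.1, q.1) d} *
        Nat.card {c // IsSplitColoring G' s(K.U, K.V) c} := by
  have := Fintype.ofFinite {d // IsSplitColoring Gs s(p.1, q.1) d}
  rw [Nat.card_congr (hK.splitColoringEquiv hG' hcol p q), Nat.card_sigma, Finset.mul_sum,
    Finset.sum_congr rfl (g := fun _ => Nat.card {c // IsSplitColoring G' s(K.U, K.V) c}),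
    Finset.sum_const, Finset.card_univ, smul_eq_mul, ← Nat.card_eq_fintype_card]
  rintro ⟨d, hd⟩ -
  have hp := K.inner_ne p
  have hq := K.inner_ne q
  refine card_splitColoring_eq hG' hg' hcol K.adj_UV hK.Tneg_ne_V ((K.adj_U_iff _).2 (by simp))
    hK.Wneg_ne_U ((K.adj_V_iff _).2 (by simp)) ?_ ?_
  · rw [hd.ne_zero_iff, adj_u_iff]
    refine ⟨⟨1, rfl⟩, fun h => ?_⟩
    rw [Sym2.eq_iff] at h
    grind
  · rw [hd.ne_zero_iff, adj_v_iff]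
    refine ⟨⟨1, rfl⟩, fun h => ?_⟩
    rw [Sym2.eq_iff] at h
    grind

end SuperpositionData
end Snark

theorem theorem5p3 {α β : Type*} [Finite α] [Finite β]
    (G' : SimpleGraph α) (Gs : SimpleGraph β)
    (hG' : Snark.IsSnark G') (hGs : Snark.IsSnark Gs)
    (K : Snark.SuperpositionData G' Gs) :
    -- the superposition is a cubic graph of girth at least 5
    Snark.IsCubic K.graph ∧ 5 ≤ K.graph.egirth ∧
    -- every edge of `G* - {u, v}` is an edge of the superposition, and the formula holds for it
    ∀ e ∈ (Gs.induce ({K.u, K.v}ᶜ : Set β)).edgeSet,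
      e.map .inner ∈ K.graph.edgeSet ∧
      Snark.psi K.graph (e.map .inner) =
        2 * Snark.psi Gs (e.map Subtype.val) * Snark.psi G' s(K.U, K.V) := by
  have hK := K.distinct hG'.cubic hG'.girth hGs.cubic
  have hcubic := hK.isCubic hG'.cubic hGs.cubic
  have hgirth := hK.five_le_egirth hG'.girth hGs.girth
  refine ⟨hcubic, hgirth, fun e he => ?_⟩
  induction e with
  | h p q =>
    have hpq : Gs.Adj p q := he
    have hpq' : K.graph.Adj (.inner p) (.inner q) := K.adj_inner_inner.2 hpq
    refine ⟨hpq', ?_⟩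
    simp only [Sym2.map_mk]
    have := K.finite_vertex
    rw [Snark.psi_eq hcubic hgirth hpq', Snark.psi_eq hGs.cubic hGs.girth hpq,
      Snark.psi_eq hG'.cubic hG'.girth K.adj_UV]
    -- With each `psi` equal to a count over 18, the factor in the formula is `18 / 9 = 2`.
    have h := congrArg (Nat.cast (R := ℚ)) (hK.nine_mul_card hG'.cubic hG'.girth hG'.uncolorable p q)
    push_cast at h
    linarith
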